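/- A cubical $d$-polytope is a $d$-dimensional convex polytope all of whose proper faces are combinatorial cubes. The derivative complex of its boundary complex $\mathcal{C}(\partial P)$ is the abstract cubical cell complex of dimension $d-2$ whose cells are the pairs $(F,[e])$, where $F$ is a proper face of $P$ of dimension at least $1$ and $[e]$ is a parallel class of edges of $F$ (parallelism of edges of $F$ being the equivalence relation generated by being opposite in a quadrilateral $2$-face of $F$); the cell $(F,[e])$ has dimension $\dim F-1$, and $(G,[e'])$ is a face of $(F,[e])$ if and only if $G\subseteq F$ and $[e']\subseteq[e]$. This complex is a (possibly disconnected) $(d-2)$-manifold without boundary, and its connected components are called the dual manifolds of $P$. **Corollary.** For every $d\ge 4$ there exists a cubical $d$-polytope that has a non-orientable dual manifold. -/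

import Mathlib

namespace Cubical

section Polytopes

variable {E : Type*} [AddCommGroup E] [Module ℝ E] [TopologicalSpace E]

/-- A (convex) polytope is the convex hull of a finite set of points. -/
def IsPolytope (P : Set E) : Prop :=
  ∃ S : Set E, S.Finite ∧ P = convexHull ℝ S

/-- The dimension of a nonempty convex set: the dimension of its affine hull. -/
noncomputable def dim (P : Set E) : ℕ :=
  Module.finrank ℝ (vectorSpan ℝ P)

/-- The face lattice of a polytope `P`, ordered by inclusion: the empty set, and the sets of
maximizers over `P` of linear functionals (the zero functional gives `P` itself). -/
abbrev FaceLattice (P : Set E) : Type _ :=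
  {F : Set E // IsExposed ℝ P F}

/-- The boundary complex of `P`: the set of all proper faces of `P`. -/
def boundaryComplex (P : Set E) : Set (Set E) :=
  {F | IsExposed ℝ P F ∧ F ≠ P}

/-- `F` is a combinatorial cube: for some `k`, its face lattice is isomorphic to that of the
standard cube `[0,1]^k`. -/
def IsCombinatorialCube (F : Set E) : Prop :=
  ∃ k : ℕ, Nonempty (FaceLattice F ≃o FaceLattice (Set.Icc (0 : Fin k → ℝ) 1))

/-- `P` is a cubical `d`-polytope: a `d`-dimensional polytope all of whose (nonempty) proper faces
are combinatorial cubes. -/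
def IsCubicalPolytope (d : ℕ) (P : Set E) : Prop :=
  IsPolytope P ∧ dim P = d ∧ ∀ F ∈ boundaryComplex P, F.Nonempty → IsCombinatorialCube F

/-- `e` is an edge of the complex `C` (given by the set of its cells). -/
def IsEdge (C : Set (Set E)) (e : Set E) : Prop :=
  e ∈ C ∧ dim e = 1

/-- `e` and `f` are opposite (that is, disjoint) edges of some quadrilateral `Q` of `C` that is
contained in the cell `F`. -/
def Opposite (C : Set (Set E)) (F e f : Set E) : Prop :=
  ∃ Q ∈ C, dim Q = 2 ∧ Q ⊆ F ∧ IsEdge C e ∧ IsEdge C f ∧ e ⊆ Q ∧ f ⊆ Q ∧ Disjoint e f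

/-- The parallel class `[e]` of the edge `e` in the cell `F` of `C`: parallelism of edges of `F` is
the equivalence relation generated by being opposite in a quadrilateral contained in `F`. -/
def parallelClass (C : Set (Set E)) (F e : Set E) : Set (Set E) :=
  {f | Relation.EqvGen (Opposite C F) e f}

/-- The derivative complex of a cubical complex `C`, as the poset of its nonempty cells. The cells
are the pairs `(F, [e])` where `F` is a cell of `C` and `[e]` is a parallel class of edges of `F`;
such a cell has dimension `dim F - 1` (so the vertices are the pairs `(e, {e})` for the edges `e`
of `C`), and `(G, [e'])` is a face of `(F, [e])` iff `G ⊆ F` and `[e'] ⊆ [e]`. -/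
abbrev DerivativeComplex (C : Set (Set E)) : Type _ :=
  {x : Set E × Set (Set E) //
    x.1 ∈ C ∧ ∃ e, IsEdge C e ∧ e ⊆ x.1 ∧ x.2 = parallelClass C x.1 e}

/-- A dual manifold of the cubical complex `C` is a connected component of its derivative complex:
the set of all cells that can be reached from some cell `x` by repeatedly passing from a cell to
one of its faces or vice versa. -/
def IsDualManifold (C : Set (Set E)) (M : Set (DerivativeComplex C)) : Prop :=
  ∃ x : DerivativeComplex C, M = {y | Relation.EqvGen (· ≤ ·) x y}

end Polytopes

section Orientability

/-- The barycentric subdivision of a cell complex with poset of nonempty cells `X`: the simplices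
are the nonempty finite chains of cells. -/
def barycentricSubdivision (X : Type*) [PartialOrder X] : AbstractSimplicialComplex X where
  faces := {s | s.Nonempty ∧ IsChain (· ≤ ·) (s : Set X)}
  isRelLowerSet_faces := fun _ hs =>
    ⟨hs.1, fun _ hts ht => ⟨ht, hs.2.mono (Finset.coe_subset.2 hts)⟩⟩
  singleton_mem := fun v => ⟨Finset.singleton_nonempty v, by simp⟩

/-- A triangulated `n`-manifold `K` is orientable iff its `n`-simplices can be coherently oriented.
An orientation of the `n`-simplices is encoded as a sign `o s` for each ordering
`s = (s 0, …, s n)` of the vertices of an `n`-simplex, such that permuting the vertices multiplies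
the sign by the sign of the permutation. It is coherent if any two `n`-simplices
`{x, v 1, …, v n} ≠ {y, v 1, …, v n}` with a common `(n - 1)`-face `{v 1, …, v n}` induce opposite
orientations on it. -/
def IsOrientable {V : Type*} (n : ℕ) (K : AbstractSimplicialComplex V) : Prop :=
  ∃ o : (Fin (n + 1) ↪ V) → ℤˣ,
    (∀ s : Fin (n + 1) ↪ V, Finset.univ.map s ∈ K.faces → ∀ σ : Equiv.Perm (Fin (n + 1)),
      o (σ.toEmbedding.trans s) = Equiv.Perm.sign σ * o s) ∧
    (∀ s t : Fin (n + 1) ↪ V, Finset.univ.map s ∈ K.faces → Finset.univ.map t ∈ K.faces →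
      (∀ i, i ≠ 0 → s i = t i) → s 0 ≠ t 0 → o s = - o t)

end Orientability

end Cubical

/-!
# Cubical polytopes with a non-orientable dual manifold

The starting point is a regular subdivision of a 3-dimensional convex polytope into twelve
combinatorial cubes (with 36 vertices and 34 boundary quadrilaterals), that is, one given by the
domains of linearity of a concave height function `g`. It contains a Möbius strip of quadrilaterals
in which consecutive quadrilaterals share opposite edges. With `m = d - 3`, the polytope consists of
the points `(x, y)` with `x` in this ball, `y ∈ ℝ^m` and `|y i| ≤ g x`. Its facets are combinatorial
products of cells and `(m - 1)`-cubes, and of boundary quadrilaterals and `m`-cubes.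

Flags of the derivative complex that differ in one cell have opposite signs in every coherent
orientation, and going around the Möbius strip yields a closed walk of odd length.
-/

open Set Module

namespace Cubical

/-! ### Affine inequalities, relative interior points and exposed faces -/

section Polyhedra

variable {E : Type*} [NormedAddCommGroup E] [NormedSpace ℝ E]

/-! The obstruction is three-dimensional. In a cubical 3-ball the edges crossed by a dual surface
span its normal direction. If a cyclic strip of quadrilaterals, glued along opposite edges, is a
Möbius strip, the normal bundle is twisted along the core curve. Since the ball is orientable, that
curve reverses the orientation of the dual surface.

To pass to dimension `d`, the ball carries a positive concave height `g`, the minimum of twelve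
affine functions, and the polytope is given by `|y i| ≤ g x`. The graph `y = (g x, …, g x)` copies
the ball into the boundary complex. Freeing all fiber coordinates but one extends flags of the ball
to full flags of the derivative complex.

Cubicality is certified locally by `IsCubicalSystem`: each inequality needs only a labelled cube of
vertices where it is tight, and further inequalities tight exactly on the facets of that cube.
Moving along a line until an inequality becomes tight (`exists_exit`, `mem_of_exits`) then shows
that nothing else lies in the polyhedron, and `IsCubeFrame.isCombinatorialCube_of_isExposed` treats
the lower faces. For the ball the certificate is a finite integer computation.

An orientation yields a sign on full flags that flips whenever one cell is exchanged
(`exists_sign_of_isOrientable`). Each step between flags of the ball flips it as well, so the closed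
walk of 41 steps along the Möbius strip forces a sign to equal its negative
(`not_isOrientable_component`). -/

lemma exists_pos_forall_lineMap_nonneg {J : Type*} [Finite J] (a : J → E →ᵃ[ℝ] ℝ) {p x : E}
    (hp : ∀ j, 0 ≤ a j p) (hx : ∀ j, a j p = 0 → a j x = 0) :
    ∃ ε : ℝ, 0 < ε ∧ ∀ j, 0 ≤ a j (AffineMap.lineMap x p (1 + ε)) := by
  have key : ∀ j, ∀ᶠ ε : ℝ in nhdsWithin 0 (Ioi 0),
      0 ≤ a j (AffineMap.lineMap x p (1 + ε)) := by
    intro j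
    have hform : ∀ ε : ℝ, a j (AffineMap.lineMap x p (1 + ε)) = a j p + ε * (a j p - a j x) := by
      intro ε
      rw [AffineMap.apply_lineMap, AffineMap.lineMap_apply_ring']
      ring
    simp only [hform]
    rcases (hp j).eq_or_lt with h | h
    · rw [hx j h.symm, ← h]
      simp
    · have hc : Continuous fun ε : ℝ => a j p + ε * (a j p - a j x) := by fun_prop
      have := hc.tendsto 0
      simp only [zero_mul, add_zero] at this
      exact ((this.eventually (lt_mem_nhds h)).filter_mono nhdsWithin_le_nhds).mono
        fun _ h => h.le
  obtain ⟨ε, h1, h2⟩ := ((Filter.eventually_all.2 key).and self_mem_nhdsWithin).exists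
  exact ⟨ε, h2, h1⟩

/-- The ratio test of the simplex method: among the inequalities that decrease along `w`, the one
with the smallest ratio becomes tight first. -/
lemma exists_exit {J : Type*} [Finite J] (a : J → E →ᵃ[ℝ] ℝ) {x : E} (w : E)
    (hx : ∀ j, 0 ≤ a j x) (hw : ∃ j, (a j).linear w < 0) :
    ∃ τ : ℝ, 0 ≤ τ ∧ (∀ j, 0 ≤ a j (x + τ • w)) ∧ ∃ j, a j (x + τ • w) = 0 := by
  classical
  have := Fintype.ofFinite J
  have hform : ∀ (j) (τ : ℝ), a j (x + τ • w) = a j x + τ * (a j).linear w := by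
    intro j τ
    have := (a j).map_vadd x (τ • w)
    simp only [vadd_eq_add, map_smul, smul_eq_mul] at this
    rw [add_comm x, this, add_comm]
  obtain ⟨j₀, hj₀⟩ := hw
  obtain ⟨j, hj, hmin⟩ := Finset.exists_min_image
    (Finset.univ.filter fun j => (a j).linear w < 0) (fun j => a j x / -(a j).linear w)
    ⟨j₀, by simpa using hj₀⟩
  simp only [Finset.mem_filter, Finset.mem_univ, true_and] at hj hmin
  have hτ : 0 ≤ a j x / -(a j).linear w := div_nonneg (hx j) (by linarith)
  refine ⟨_, hτ, fun k => ?_, j, ?_⟩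
  · rw [hform]
    by_cases hk : (a k).linear w < 0
    · have := hmin k hk
      rw [le_div_iff₀ (by linarith)] at this
      linarith
    · have := mul_nonneg hτ (not_lt.1 hk)
      linarith [hx k]
  · rw [hform, div_neg, neg_mul, div_mul_cancel₀ _ hj.ne, add_neg_cancel]

/-- A substitute for a relative interior point. Taking the midpoint with a witness for one more
inequality preserves the strict inequalities already obtained. -/
lemma exists_mem_forall_pos {J : Type*} [Finite J] (a : J → E →ᵃ[ℝ] ℝ) {X : Set E}
    (hX : Convex ℝ X) (hne : X.Nonempty) (h : ∀ x ∈ X, ∀ j, 0 ≤ a j x) :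
    ∃ p ∈ X, ∀ j, (∃ x ∈ X, 0 < a j x) → 0 < a j p := by
  classical
  have := Fintype.ofFinite J
  suffices H : ∀ s : Finset J, ∃ p ∈ X, ∀ j ∈ s, (∃ x ∈ X, 0 < a j x) → 0 < a j p by
    simpa using H Finset.univ
  intro s
  induction s using Finset.induction_on with
  | empty =>
    obtain ⟨x, hx⟩ := hne
    exact ⟨x, hx, by simp⟩
  | insert k s _ ih =>
    obtain ⟨p, hp, hps⟩ := ih
    by_cases hk : ∃ x ∈ X, 0 < a k x
    · obtain ⟨x, hx, hxk⟩ := hk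
      have hmid : ∀ j, a j (midpoint ℝ p x) = (a j p + a j x) / 2 := by
        intro j
        rw [AffineMap.map_midpoint, midpoint_eq_smul_add, smul_eq_mul]
        simp
        ring
      refine ⟨midpoint ℝ p x, hX.midpoint_mem hp hx, fun j hj hjX => ?_⟩
      rw [hmid]
      rcases Finset.mem_insert.1 hj with rfl | hj
      · linarith [h p hp j]
      · linarith [hps j hj hjX, h x hx j]
    · refine ⟨p, hp, fun j hj hjX => ?_⟩
      rcases Finset.mem_insert.1 hj with rfl | hj
      · exact absurd hjX hk
      · exact hps j hj hjX

/-- A functional that is maximal at `p` and does not grow just beyond `p` cannot be smaller at `x`.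
With `exists_pos_forall_lineMap_nonneg`, a relative interior point of a face thus determines the
face. -/
lemma IsExposed.mem_of_lineMap_mem {P X : Set E} (hX : IsExposed ℝ P X) {p x : E} (hp : p ∈ X)
    (hx : x ∈ P) {ε : ℝ} (hε : 0 < ε) (h : AffineMap.lineMap x p (1 + ε) ∈ P) : x ∈ X := by
  obtain ⟨l, rfl⟩ := hX ⟨p, hp⟩
  refine ⟨hx, fun y hy => (hp.2 y hy).trans ?_⟩
  have h1 := hp.2 _ h
  rw [AffineMap.lineMap_apply] at h1
  simp only [vsub_eq_sub, vadd_eq_add, map_add, map_smul, map_sub, smul_eq_mul] at h1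
  nlinarith

lemma affine_sub {E : Type*} [AddCommGroup E] [Module ℝ E] (f : E →ᵃ[ℝ] ℝ) (x y : E) :
    f.linear (x - y) = f x - f y := by
  rw [← vsub_eq_sub x y, AffineMap.linearMap_vsub, vsub_eq_sub]

lemma isExposed_zeros [FiniteDimensional ℝ E] {P : Set E} (f : E →ᵃ[ℝ] ℝ)
    (hf : ∀ x ∈ P, 0 ≤ f x) : IsExposed ℝ P {x ∈ P | f x = 0} := by
  rintro ⟨x₀, hx₀, h₀⟩
  refine ⟨LinearMap.toContinuousLinearMap (-f.linear), ?_⟩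
  have hlin : ∀ x y, f.linear x - f.linear y = f x - f y := fun x y => by
    rw [← map_sub, affine_sub]
  ext x
  simp only [mem_ofPred_eq, LinearMap.coe_toContinuousLinearMap', LinearMap.neg_apply]
  refine and_congr_right fun hx => ⟨fun h y hy => ?_, fun h => ?_⟩
  · linarith [hlin x y, hf y hy]
  · linarith [hlin x x₀, h x₀ hx₀, hf x hx]

lemma IsExposed.of_subset {P Q X : Set E} (hX : IsExposed ℝ P X) (hXQ : X ⊆ Q) (hQP : Q ⊆ P) :
    IsExposed ℝ Q X := by
  intro hne
  obtain ⟨l, hl⟩ := hX hne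
  obtain ⟨x₀, hx₀⟩ := hne
  refine ⟨l, Subset.antisymm (fun x hx => ⟨hXQ hx, fun y hy => ?_⟩) fun x hx => ?_⟩
  · rw [hl] at hx
    exact hx.2 y (hQP hy)
  · have h₀ := hX ⟨x₀, hx₀⟩
    rw [hl] at hx₀ ⊢
    exact ⟨hQP hx.1, fun y hy => (hx₀.2 y hy).trans (hx.2 x₀ (hXQ (hl ▸ hx₀)))⟩

/-- Krein–Milman for the face: its extreme points are extreme in the whole hull, hence lie in `T`.
-/
lemma IsExposed.eq_convexHull [FiniteDimensional ℝ E] {T X : Set E} (hT : T.Finite)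
    (hX : IsExposed ℝ (convexHull ℝ T) X) : X = convexHull ℝ (T ∩ X) := by
  have hc : IsCompact (convexHull ℝ T) := hT.isCompact_convexHull ℝ
  have hXc : Convex ℝ X := hX.convex (convex_convexHull ℝ T)
  refine Subset.antisymm ?_ (convexHull_min inter_subset_right hXc)
  have hsub : X.extremePoints ℝ ⊆ T ∩ X := fun x hx =>
    ⟨extremePoints_convexHull_subset (hX.isExtreme.extremePoints_subset_extremePoints hx), hx.1⟩
  have hcl : IsClosed (convexHull ℝ (T ∩ X)) := (hT.subset inter_subset_left).isClosed_convexHull ℝ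
  have := closure_minimal (convexHull_mono (𝕜 := ℝ) hsub) hcl
  rwa [closure_convexHull_extremePoints (hX.isCompact hc) hXc] at this

end Polyhedra

/-! ### Recognizing combinatorial cubes from vertices and facet inequalities -/

section CubeFrames

/-- A set of vertices of the cube that is either empty or the vertex set of a face: it contains
every vertex that shares all coordinates which are constant on it. -/
def IsSubcube {ι : Type*} (S : Set (ι → Bool)) : Prop :=
  S.Nonempty → ∀ t, (∀ i b, (∀ s ∈ S, s i = b) → t i = b) → t ∈ S

variable {E : Type*} [NormedAddCommGroup E] [NormedSpace ℝ E]

/-- Points `v s`, indexed by the vertices of a cube, together with affine functions `a i b` that are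
nonnegative at these points and vanish at those of the facet `s i = b`. -/
structure IsCubeFrame {ι : Type*} [Fintype ι] (W : Submodule ℝ E) (v : (ι → Bool) → E)
    (a : ι → Bool → E →ᵃ[ℝ] ℝ) : Prop where
  sub_mem : ∀ s t, v s - v t ∈ W
  nonneg : ∀ i b s, 0 ≤ a i b (v s)
  eq_zero_iff : ∀ i b s, a i b (v s) = 0 ↔ s i = b
  finrank_le : finrank ℝ W ≤ Fintype.card ι

open Classical in
/-- The vertex of the facet `s i = b` with the given remaining coordinates. -/
noncomputable def extendAt {ι : Type*} (i : ι) (b : Bool) (s : {j // j ≠ i} → Bool) : ι → Bool :=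
  fun j => if h : j = i then b else s ⟨j, h⟩

@[simp] lemma extendAt_self {ι : Type*} (i : ι) (b : Bool) (s : {j // j ≠ i} → Bool) :
    extendAt i b s i = b := by simp [extendAt]

@[simp] lemma extendAt_coe {ι : Type*} (i : ι) (b : Bool) (s : {j // j ≠ i} → Bool)
    (j : {j // j ≠ i}) : extendAt i b s j = s j := by simp [extendAt, j.2]

lemma extendAt_restrict {ι : Type*} {i : ι} {b : Bool} {s : ι → Bool} (h : s i = b) :
    extendAt i b (fun j => s j) = s := by
  ext j
  by_cases hj : j = i
  · subst hj
    simp [h]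
  · simp [extendAt, hj]

lemma mem_of_exits {K : Set E} (hK : Convex ℝ K) {x w : E} {τ σ : ℝ} (hτ : 0 ≤ τ) (hσ : 0 ≤ σ)
    (h1 : x + τ • w ∈ K) (h2 : x - σ • w ∈ K) : x ∈ K := by
  rcases (add_nonneg hτ hσ).eq_or_lt with h0 | h0
  · obtain rfl : τ = 0 := by linarith
    simpa using h1
  · have e1 : σ / (τ + σ) + τ / (τ + σ) = 1 := by rw [← add_div, add_comm, div_self h0.ne']
    have := hK h1 h2 (div_nonneg hσ h0.le) (div_nonneg hτ h0.le) e1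
    convert this using 1
    have e2 : σ / (τ + σ) * τ = τ / (τ + σ) * σ := by ring
    calc x = (σ / (τ + σ) + τ / (τ + σ)) • x := by rw [e1, one_smul]
      _ = _ := by
        rw [smul_add, smul_sub, smul_smul, smul_smul, e2, add_smul]
        abel

namespace IsCubeFrame

variable {ι : Type} [Fintype ι] {W : Submodule ℝ E} {v : (ι → Bool) → E}
  {a : ι → Bool → E →ᵃ[ℝ] ℝ}

open Classical in
lemma restrict [FiniteDimensional ℝ E] (h : IsCubeFrame W v a) (i : ι) (b : Bool) :
    IsCubeFrame (W ⊓ LinearMap.ker (a i b).linear) (fun s => v (extendAt i b s))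
      (fun j : {j // j ≠ i} => a j) where
  sub_mem s t := by
    refine ⟨h.sub_mem _ _, ?_⟩
    simp [affine_sub, (h.eq_zero_iff i b _).2 (extendAt_self i b _)]
  nonneg j c s := h.nonneg j c _
  eq_zero_iff j c s := by rw [h.eq_zero_iff, extendAt_coe]
  finrank_le := by
    -- `a i b` vanishes at the constant vertex `b` but not at the opposite one, so its linear part
    -- is nonzero on `W` and the dimension drops.
    have hlt : W ⊓ LinearMap.ker (a i b).linear < W := by
      refine lt_of_le_of_ne inf_le_left fun heq => ?_
      have hmem := h.sub_mem (fun _ => b) (fun _ => !b)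
      rw [← heq] at hmem
      have := hmem.2
      simp only [SetLike.mem_coe, LinearMap.mem_ker, affine_sub,
        (h.eq_zero_iff i b (fun _ => b)).2 rfl, zero_sub, neg_eq_zero, h.eq_zero_iff] at this
      simp at this
    have h1 := Submodule.finrank_lt_finrank_of_lt hlt
    have h2 := h.finrank_le
    have h3 : Fintype.card {j // j ≠ i} = Fintype.card ι - 1 := by
      simp [Fintype.card_subtype_compl]
    omega

/-- Induction on the dimension of the cube. The line through `x` parallel to a main diagonal meets
some inequality tightly in both directions; the two exit points lie in facets, which are frames of
smaller dimension, and `x` lies between them. The bound on `finrank ℝ W` makes `W` trivial in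
dimension zero. -/
lemma mem_convexHull [FiniteDimensional ℝ E] (h : IsCubeFrame W v a) {x : E} {t : ι → Bool}
    (hx : x - v t ∈ W) (hpos : ∀ i b, 0 ≤ a i b x) : x ∈ convexHull ℝ (range v) := by
  classical
  induction hn : Fintype.card ι generalizing ι W x with
  | zero =>
    have hW : W = ⊥ := by
      have := h.finrank_le
      rw [hn, Nat.le_zero] at this
      exact Submodule.finrank_eq_zero.1 this
    rw [hW, Submodule.mem_bot, sub_eq_zero] at hx
    exact subset_convexHull ℝ _ ⟨t, hx.symm⟩
  | succ n ih =>
    have hx' : ∀ s, x - v s ∈ W := fun s => by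
      simpa using W.add_mem hx (h.sub_mem t s)
    have facet : ∀ y : E, y - x ∈ W → (∀ i b, 0 ≤ a i b y) → (∃ i b, a i b y = 0) →
        y ∈ convexHull ℝ (range v) := by
      rintro y hy hypos ⟨i, b, hib⟩
      refine convexHull_mono ?_ (ih (h.restrict i b) (x := y) (t := fun _ => true) ⟨?_, ?_⟩
        (fun j c => hypos j c) ?_)
      · rintro _ ⟨s, rfl⟩
        exact ⟨_, rfl⟩
      · simpa using W.add_mem hy (hx' (extendAt i b fun _ => true))
      · simp [affine_sub, hib, (h.eq_zero_iff i b _).2 (extendAt_self i b _)]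
      · simp [Fintype.card_subtype_compl, hn]
    have : Nonempty ι := Fintype.card_pos_iff.1 (by omega)
    obtain ⟨i⟩ := this
    have exits : ∀ s s' : ι → Bool, s i ≠ s' i → ∃ τ : ℝ, 0 ≤ τ ∧
        x + τ • (v s - v s') ∈ convexHull ℝ (range v) := by
      intro s s' hs
      have hneg : (a i (s i)).linear (v s - v s') < 0 := by
        rw [affine_sub, (h.eq_zero_iff i _ s).2 rfl, zero_sub, neg_lt_zero]
        exact (h.nonneg _ _ _).lt_of_ne' fun h0 => hs ((h.eq_zero_iff _ _ _).1 h0).symm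
      obtain ⟨τ, hτ, h1, ⟨j, c⟩, h2⟩ := exists_exit (fun j : ι × Bool => a j.1 j.2)
        (v s - v s') (fun j => hpos j.1 j.2) ⟨(i, s i), hneg⟩
      refine ⟨τ, hτ, facet _ ?_ (fun i b => h1 (i, b)) ⟨j, c, h2⟩⟩
      simpa using W.smul_mem τ (h.sub_mem s s')
    obtain ⟨τ, hτ, h1⟩ := exits (fun _ => true) (fun _ => false) (by simp)
    obtain ⟨σ, hσ, h2⟩ := exits (fun _ => false) (fun _ => true) (by simp)
    set w := v (fun _ => true) - v (fun _ => false)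
    rw [← neg_sub, smul_neg] at h2
    exact mem_of_exits (convex_convexHull ℝ _) hτ hσ h1 (by rwa [← sub_eq_add_neg] at h2)

lemma nonneg_of_mem (h : IsCubeFrame W v a) {x : E} (hx : x ∈ convexHull ℝ (range v)) (i : ι)
    (b : Bool) : 0 ≤ a i b x := by
  have : convexHull ℝ (range v) ⊆ (a i b) ⁻¹' Ici 0 :=
    convexHull_min (by rintro _ ⟨s, rfl⟩; exact h.nonneg i b s)
      ((convex_Ici (0 : ℝ)).affine_preimage _)
  exact this hx

lemma sub_mem_of_mem (h : IsCubeFrame W v a) {x : E} (hx : x ∈ convexHull ℝ (range v))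
    (t : ι → Bool) : x - v t ∈ W := by
  have : convexHull ℝ (range v) ⊆ {x | x - v t ∈ W} := by
    refine convexHull_min (by rintro _ ⟨s, rfl⟩; exact h.sub_mem s t) ?_
    intro x hx y hy α β _ _ hαβ
    have := W.add_mem (W.smul_mem α hx) (W.smul_mem β hy)
    rw [smul_sub, smul_sub, sub_add_sub_comm, ← add_smul, hαβ, one_smul] at this
    exact this
  exact this hx

/-- Inequalities tight at a relative interior point `p` of `X` are tight on all of `X`, hence at `v
t`. The segment from `v t` can therefore be prolonged beyond `p` within the cube, which puts `v t`
in `X`. -/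
lemma isSubcube_preimage [FiniteDimensional ℝ E] (h : IsCubeFrame W v a) {X : Set E}
    (hX : IsExposed ℝ (convexHull ℝ (range v)) X) : IsSubcube (v ⁻¹' X) := by
  rintro ⟨s₀, hs₀⟩ t ht
  have hXsub := hX.subset
  obtain ⟨p, hpX, hp⟩ := exists_mem_forall_pos (fun j : ι × Bool => a j.1 j.2)
    (hX.convex (convex_convexHull ℝ _)) ⟨_, hs₀⟩
    (fun x hx j => h.nonneg_of_mem (hXsub hx) _ _)
  have hzero : ∀ j : ι × Bool, a j.1 j.2 p = 0 → a j.1 j.2 (v t) = 0 := by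
    rintro ⟨i, b⟩ h0
    refine (h.eq_zero_iff i b t).2 (ht i b fun s hs => (h.eq_zero_iff i b s).1 ?_)
    by_contra hne
    exact (hp (i, b) ⟨v s, hs, (h.nonneg i b s).lt_of_ne' hne⟩).ne' h0
  obtain ⟨ε, hε, hpos⟩ := exists_pos_forall_lineMap_nonneg (fun j : ι × Bool => a j.1 j.2)
    (fun j => h.nonneg_of_mem (hXsub hpX) _ _) hzero
  refine IsExposed.mem_of_lineMap_mem hX hpX (subset_convexHull ℝ _ ⟨t, rfl⟩) hε
    (h.mem_convexHull (t := t) ?_ fun i b => hpos (i, b))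
  rw [AffineMap.lineMap_apply, vsub_eq_sub, vadd_eq_add, add_sub_cancel_right]
  exact W.smul_mem _ (h.sub_mem_of_mem (hXsub hpX) t)

lemma exists_isExposed [FiniteDimensional ℝ E] (h : IsCubeFrame W v a) {S : Set (ι → Bool)}
    (hS : IsSubcube S) :
    ∃ X, IsExposed ℝ (convexHull ℝ (range v)) X ∧ v ⁻¹' X = S := by
  classical
  rcases S.eq_empty_or_nonempty with rfl | hne
  · exact ⟨∅, fun h => absurd h (by simp), rfl⟩
  -- The face is exposed by the sum of the facet functions that vanish on all of `S`.
  · let J : Finset (ι × Bool) := Finset.univ.filter fun j => ∀ s ∈ S, s j.1 = j.2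
    let f : E →ᵃ[ℝ] ℝ := ∑ j ∈ J, a j.1 j.2
    have hf : ∀ x, f x = ∑ j ∈ J, a j.1 j.2 x := fun x => by
      simp only [f]
      induction J using Finset.induction_on with
      | empty => simp
      | insert k s hk ih => rw [Finset.sum_insert hk, Finset.sum_insert hk, ← ih]; simp
    refine ⟨_, isExposed_zeros f fun x hx => ?_, ?_⟩
    · rw [hf]
      exact Finset.sum_nonneg fun j _ => h.nonneg_of_mem hx _ _
    · ext t
      simp only [mem_preimage, mem_ofPred_eq, hf]
      rw [and_iff_right (subset_convexHull ℝ _ (mem_range_self t)),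
        Finset.sum_eq_zero_iff_of_nonneg fun j _ => h.nonneg _ _ _]
      simp only [h.eq_zero_iff]
      constructor
      · exact fun ht => hS hne t fun i b hib => ht (i, b) (by simpa [J] using hib)
      · exact fun ht j hj => (Finset.mem_filter.1 hj).2 t ht

lemma eq_convexHull_preimage [FiniteDimensional ℝ E] {X : Set E}
    (hX : IsExposed ℝ (convexHull ℝ (range v)) X) :
    X = convexHull ℝ (v '' (v ⁻¹' X)) := by
  rw [image_preimage_eq_inter_range, inter_comm]
  exact IsExposed.eq_convexHull (finite_range v) hX

lemma nonempty_orderIso [FiniteDimensional ℝ E] (h : IsCubeFrame W v a) :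
    Nonempty (FaceLattice (convexHull ℝ (range v)) ≃o {S : Set (ι → Bool) // IsSubcube S}) := by
  let f : FaceLattice (convexHull ℝ (range v)) ↪o {S : Set (ι → Bool) // IsSubcube S} :=
    OrderEmbedding.ofMapLEIff (fun X => ⟨v ⁻¹' X.1, h.isSubcube_preimage X.2⟩) (by
      rintro ⟨X, hX⟩ ⟨Y, hY⟩
      refine ⟨fun hXY => ?_, fun hXY => preimage_mono hXY⟩
      show X ⊆ Y
      rw [eq_convexHull_preimage hX, eq_convexHull_preimage hY]
      exact convexHull_mono (image_mono hXY))
  refine ⟨RelIso.ofSurjective f ?_⟩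
  rintro ⟨S, hS⟩
  obtain ⟨X, hX, hXS⟩ := h.exists_isExposed hS
  exact ⟨⟨X, hX⟩, Subtype.ext hXS⟩

lemma reindex (h : IsCubeFrame W v a) {κ : Type} [Fintype κ] (e : κ ≃ ι) :
    IsCubeFrame W (fun s : κ → Bool => v (s ∘ e.symm)) (fun k => a (e k)) where
  sub_mem _ _ := h.sub_mem _ _
  nonneg _ _ _ := h.nonneg _ _ _
  eq_zero_iff k b s := by rw [h.eq_zero_iff]; simp
  finrank_le := by rw [Fintype.card_congr e]; exact h.finrank_le

end IsCubeFrame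

/-- The vertices of the standard cube. -/
def stdVertex (k : ℕ) (s : Fin k → Bool) : Fin k → ℝ := fun i => if s i then 1 else 0

/-- The affine functions that define the facets of the standard cube. -/
noncomputable def stdFacet (k : ℕ) (i : Fin k) (b : Bool) : (Fin k → ℝ) →ᵃ[ℝ] ℝ :=
  if b then AffineMap.const ℝ _ 1 - (LinearMap.proj i : (Fin k → ℝ) →ₗ[ℝ] ℝ).toAffineMap
  else (LinearMap.proj i : (Fin k → ℝ) →ₗ[ℝ] ℝ).toAffineMap

lemma isCubeFrame_std (k : ℕ) : IsCubeFrame ⊤ (stdVertex k) (stdFacet k) where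
  sub_mem _ _ := trivial
  nonneg i b s := by cases b <;> cases hs : s i <;> simp [stdFacet, stdVertex, hs]
  eq_zero_iff i b s := by cases b <;> cases hs : s i <;> simp [stdFacet, stdVertex, hs]
  finrank_le := by simp

lemma convexHull_stdVertex (k : ℕ) : convexHull ℝ (range (stdVertex k)) = Icc 0 1 := by
  refine Subset.antisymm (convexHull_min ?_ (convex_Icc 0 1)) fun x hx => ?_
  · rintro _ ⟨s, rfl⟩
    constructor <;> intro i <;> cases hs : s i <;> simp [stdVertex, hs]
  · refine (isCubeFrame_std k).mem_convexHull (t := fun _ => true) trivial fun i b => ?_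
    have h0 := hx.1 i
    have h1 := hx.2 i
    cases b
    · simpa [stdFacet] using h0
    · simpa [stdFacet] using h1

namespace IsCubeFrame

variable {ι : Type} [Fintype ι] {W : Submodule ℝ E} {v : (ι → Bool) → E}
  {a : ι → Bool → E →ᵃ[ℝ] ℝ}

lemma isCombinatorialCube [FiniteDimensional ℝ E] (h : IsCubeFrame W v a) :
    IsCombinatorialCube (convexHull ℝ (range v)) := by
  refine ⟨Fintype.card ι, ?_⟩
  let e := (Fintype.equivFin ι).symm
  have hr : range (fun s : Fin (Fintype.card ι) → Bool => v (s ∘ e.symm)) = range v := by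
    ext x
    constructor
    · rintro ⟨s, rfl⟩
      exact ⟨_, rfl⟩
    · rintro ⟨s, rfl⟩
      exact ⟨s ∘ e, by simp [Function.comp_assoc]⟩
  obtain ⟨f⟩ := (h.reindex e).nonempty_orderIso
  obtain ⟨g⟩ := (isCubeFrame_std (Fintype.card ι)).nonempty_orderIso
  rw [hr] at f
  rw [convexHull_stdVertex] at g
  exact ⟨f.trans g.symm⟩

/-- Either some coordinate is constant on the vertices of `X`, and `X` is a face of the
corresponding facet, or `X` contains every vertex and is the whole cube. -/
lemma isCombinatorialCube_of_isExposed [FiniteDimensional ℝ E] (h : IsCubeFrame W v a) {X : Set E}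
    (hX : IsExposed ℝ (convexHull ℝ (range v)) X) (hne : X.Nonempty) :
    IsCombinatorialCube X := by
  classical
  induction hn : Fintype.card ι using Nat.strong_induction_on generalizing ι W with
  | _ n ih =>
    have hS := h.isSubcube_preimage hX
    have hSne : (v ⁻¹' X).Nonempty := by
      by_contra hS0
      rw [not_nonempty_iff_eq_empty] at hS0
      rw [eq_convexHull_preimage hX, hS0] at hne
      simp at hne
    by_cases hfix : ∃ i b, ∀ s ∈ v ⁻¹' X, s i = b
    · obtain ⟨i, b, hib⟩ := hfix
      have hr := h.restrict i b
      refine ih (Fintype.card {j // j ≠ i}) ?_ hr ?_ rfl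
      · have : 0 < Fintype.card ι := Fintype.card_pos_iff.2 ⟨i⟩
        simp only [Fintype.card_subtype_compl, Fintype.card_unique, ne_eq]
        omega
      · refine IsExposed.of_subset hX ?_ (convexHull_mono ?_)
        · rw [eq_convexHull_preimage hX]
          refine convexHull_mono ?_
          rintro _ ⟨s, hs, rfl⟩
          exact ⟨fun j => s j, congrArg v (extendAt_restrict (hib s hs))⟩
        · rintro _ ⟨s, rfl⟩
          exact ⟨_, rfl⟩
    · have huniv : v ⁻¹' X = univ := eq_univ_of_forall fun t =>
        hS hSne t fun i b hib => absurd ⟨i, b, hib⟩ hfix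
      rw [eq_convexHull_preimage hX, huniv, image_univ]
      exact h.isCombinatorialCube

end IsCubeFrame

end CubeFrames

/-! ### From local certificates to cubical polytopes -/

section CubicalSystems

variable {E : Type*} [NormedAddCommGroup E] [NormedSpace ℝ E] [FiniteDimensional ℝ E]

/-- The solution set of a system of affine inequalities. -/
def polyhedron {J : Type*} (ℓ : J → E →ᵃ[ℝ] ℝ) : Set E := {x | ∀ j, 0 ≤ ℓ j x}

/-- A system of inequalities and a set `T` of solutions such that every inequality is tight at
the vertices of a cube in `T`, whose facets are cut out by further inequalities of the system. -/
structure IsCubicalSystem {J : Type*} (ℓ : J → E →ᵃ[ℝ] ℝ) (T : Set E) : Prop where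
  subset : T ⊆ polyhedron ℓ
  facet : ∀ j, ∃ (ι : Type) (_ : Fintype ι) (v : (ι → Bool) → E) (nb : ι → Bool → J),
    Fintype.card ι + 1 = finrank ℝ E ∧ (∀ s, v s ∈ T) ∧ (∀ s, ℓ j (v s) = 0) ∧
      ∀ i b s, ℓ (nb i b) (v s) = 0 ↔ s i = b
  pos : ∀ j, ∃ x ∈ T, 0 < ℓ j x

omit [FiniteDimensional ℝ E] in
lemma convex_polyhedron {J : Type*} (ℓ : J → E →ᵃ[ℝ] ℝ) : Convex ℝ (polyhedron ℓ) := by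
  have : polyhedron ℓ = ⋂ j, (ℓ j) ⁻¹' Ici 0 := by
    ext x
    simp [polyhedron]
  rw [this]
  exact convex_iInter fun j => (convex_Ici (0 : ℝ)).affine_preimage _

namespace IsCubicalSystem

variable {J : Type*} {ℓ : J → E →ᵃ[ℝ] ℝ} {T : Set E}

lemma exists_isCubeFrame (h : IsCubicalSystem ℓ T) (j : J) :
    ∃ (ι : Type) (_ : Fintype ι) (W : Submodule ℝ E) (v : (ι → Bool) → E)
      (nb : ι → Bool → J), Fintype.card ι + 1 = finrank ℝ E ∧ range v ⊆ T ∧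
      IsCubeFrame W v (fun i b => ℓ (nb i b)) ∧
      polyhedron ℓ ∩ {x | ℓ j x = 0} = convexHull ℝ (range v) := by
  obtain ⟨ι, _, v, nb, hcard, hT, hj, hnb⟩ := h.facet j
  have hvT : range v ⊆ T := by
    rintro _ ⟨s, rfl⟩
    exact hT s
  have hframe : IsCubeFrame (LinearMap.ker (ℓ j).linear) v (fun i b => ℓ (nb i b)) := by
    refine ⟨fun s t => ?_, fun i b s => h.subset (hT s) _, hnb, ?_⟩
    · simp [affine_sub, hj]
    -- By `pos`, `ℓ j` is not identically zero, so its hyperplane has dimension at most `finrank ℝ E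
    -- - 1`, the dimension of the cube.
    · have hlt : LinearMap.ker (ℓ j).linear < ⊤ := by
        refine lt_top_iff_ne_top.2 fun htop => ?_
        obtain ⟨x, -, hx⟩ := h.pos j
        have h0 := hj (fun _ => true)
        have : x - v (fun _ => true) ∈ LinearMap.ker (ℓ j).linear := htop ▸ trivial
        rw [LinearMap.mem_ker, affine_sub, h0] at this
        linarith
      have := Submodule.finrank_lt_finrank_of_lt hlt
      rw [finrank_top] at this
      omega
  refine ⟨ι, _, _, v, nb, hcard, hvT, hframe, Subset.antisymm ?_ (convexHull_min ?_ ?_)⟩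
  · rintro x ⟨hx, hxj⟩
    refine hframe.mem_convexHull (t := fun _ => true) ?_ fun i b => hx _
    have hxj : ℓ j x = 0 := hxj
    simp [affine_sub, hxj, hj]
  · rintro _ ⟨s, rfl⟩
    exact ⟨h.subset (hT s), hj s⟩
  · exact (convex_polyhedron ℓ).inter ((convex_singleton (0 : ℝ)).affine_preimage (ℓ j))

/-- Boundedness is not presupposed: the line through `x` along a diagonal of one certified facet
leaves the polyhedron in both directions, and wherever it leaves, it lies in a facet already known
to be a hull of vertices. -/
lemma polyhedron_eq_convexHull [Finite J] [Nonempty J] (h : IsCubicalSystem ℓ T)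
    (hE : 2 ≤ finrank ℝ E) : polyhedron ℓ = convexHull ℝ T := by
  refine Subset.antisymm (fun x hx => ?_) (convexHull_min h.subset (convex_polyhedron ℓ))
  have facet : ∀ y ∈ polyhedron ℓ, (∃ j, ℓ j y = 0) → y ∈ convexHull ℝ T := by
    rintro y hy ⟨j, hj⟩
    obtain ⟨ι, _, W, v, nb, hcard, hvT, hframe, heq⟩ := h.exists_isCubeFrame j
    have : y ∈ convexHull ℝ (range v) := heq ▸ ⟨hy, hj⟩
    exact convexHull_mono hvT this
  obtain ⟨ι, _, W, v, nb, hcard, hvT, hframe, -⟩ := h.exists_isCubeFrame (Classical.arbitrary J)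
  obtain ⟨i⟩ : Nonempty ι := Fintype.card_pos_iff.1 (by omega)
  have exits : ∀ s s' : ι → Bool, s i ≠ s' i → ∃ τ : ℝ, 0 ≤ τ ∧
      x + τ • (v s - v s') ∈ convexHull ℝ T := by
    intro s s' hs
    have hneg : (ℓ (nb i (s i))).linear (v s - v s') < 0 := by
      rw [affine_sub, (hframe.eq_zero_iff i _ s).2 rfl, zero_sub, neg_lt_zero]
      exact (hframe.nonneg _ _ _).lt_of_ne' fun h0 => hs ((hframe.eq_zero_iff _ _ _).1 h0).symm
    obtain ⟨τ, hτ, h1, h2⟩ := exists_exit ℓ (v s - v s') hx ⟨_, hneg⟩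
    exact ⟨τ, hτ, facet _ h1 h2⟩
  obtain ⟨τ, hτ, h1⟩ := exits (fun _ => true) (fun _ => false) (by simp)
  obtain ⟨σ, hσ, h2⟩ := exits (fun _ => false) (fun _ => true) (by simp)
  rw [← neg_sub, smul_neg] at h2
  exact mem_of_exits (convex_convexHull ℝ T) hτ hσ h1 (by rwa [← sub_eq_add_neg] at h2)

variable [Finite J] [Nonempty J] (h : IsCubicalSystem ℓ T)
include h

omit [FiniteDimensional ℝ E] in
lemma exists_interior : ∃ p, ∀ j, 0 < ℓ j p := by
  obtain ⟨x, hx, -⟩ := h.pos (Classical.arbitrary J)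
  obtain ⟨p, -, hp⟩ := exists_mem_forall_pos ℓ (convex_polyhedron ℓ) ⟨x, h.subset hx⟩
    (fun x hx => hx)
  refine ⟨p, fun j => hp j ?_⟩
  obtain ⟨y, hy, hj⟩ := h.pos j
  exact ⟨y, h.subset hy, hj⟩

omit [FiniteDimensional ℝ E] in
lemma dim_polyhedron : dim (polyhedron ℓ) = finrank ℝ E := by
  obtain ⟨p, hp⟩ := h.exists_interior
  suffices H : vectorSpan ℝ (polyhedron ℓ) = ⊤ by rw [dim, H, finrank_top]
  refine eq_top_iff.2 fun u _ => ?_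
  obtain ⟨ε, hε, hpos⟩ := exists_pos_forall_lineMap_nonneg ℓ (p := p) (x := p - u)
    (fun j => (hp j).le) fun j h0 => absurd h0 (hp j).ne'
  have hmem := vsub_mem_vectorSpan ℝ (show _ ∈ polyhedron ℓ from hpos)
    (show p ∈ polyhedron ℓ from fun j => (hp j).le)
  have : (AffineMap.lineMap (p - u) p (1 + ε) : E) -ᵥ p = ε • u := by
    simp only [AffineMap.lineMap_apply, vsub_eq_sub, vadd_eq_add, add_smul, sub_sub_cancel,
      one_smul]
    abel
  rw [this] at hmem
  simpa [smul_smul, inv_mul_cancel₀ hε.ne'] using Submodule.smul_mem _ ε⁻¹ hmem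

omit [Nonempty J] in
lemma isCombinatorialCube {F : Set E} (hF : IsExposed ℝ (polyhedron ℓ) F)
    (hne : F.Nonempty) (hFP : F ≠ polyhedron ℓ) : IsCombinatorialCube F := by
  have hsub := hF.subset
  -- If no inequality were tight on all of `F`, then `F` would contain an interior point and hence
  -- be everything.
  obtain ⟨j, hj⟩ : ∃ j, ∀ x ∈ F, ℓ j x = 0 := by
    by_contra! hcon
    obtain ⟨p, hpF, hp⟩ := exists_mem_forall_pos ℓ (hF.convex (convex_polyhedron ℓ)) hne
      (fun x hx => hsub hx)
    have hp' : ∀ j, 0 < ℓ j p := fun j => hp j <| by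
      obtain ⟨x, hx, hxj⟩ := hcon j
      exact ⟨x, hx, (hsub hx j).lt_of_ne' hxj⟩
    refine hFP (Subset.antisymm hsub fun x hx => ?_)
    obtain ⟨ε, hε, hpos⟩ := exists_pos_forall_lineMap_nonneg ℓ (p := p) (x := x)
      (fun j => (hp' j).le) fun j h0 => absurd h0 (hp' j).ne'
    exact IsExposed.mem_of_lineMap_mem hF hpF hx hε hpos
  obtain ⟨ι, _, W, v, nb, hcard, hvT, hframe, heq⟩ := h.exists_isCubeFrame j
  refine hframe.isCombinatorialCube_of_isExposed (IsExposed.of_subset hF ?_ ?_) hne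
  · rw [← heq]
    exact fun x hx => ⟨hsub hx, hj x hx⟩
  · rw [← heq]
    exact inter_subset_left

theorem isCubicalPolytope (hT : T.Finite) (hE : 2 ≤ finrank ℝ E) :
    IsCubicalPolytope (finrank ℝ E) (polyhedron ℓ) :=
  ⟨⟨T, hT, h.polyhedron_eq_convexHull hE⟩, h.dim_polyhedron,
    fun _ hF hne => h.isCombinatorialCube hF.1 hne hF.2⟩

/-- A set of vertices that consists of all the common zeros of some inequalities, and is not the
set of all vertices, spans a proper face. -/
lemma convexHull_mem_boundaryComplex (hT : T.Finite) (hE : 2 ≤ finrank ℝ E) {S : Set E}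
    {Z : Set J} (hZ : Z.Nonempty) (hS : ∀ x, x ∈ S ↔ x ∈ T ∧ ∀ j ∈ Z, ℓ j x = 0) :
    convexHull ℝ S ∈ boundaryComplex (polyhedron ℓ) ∧ T ∩ convexHull ℝ S = S := by
  classical
  have := Fintype.ofFinite J
  let f : E →ᵃ[ℝ] ℝ := ∑ j ∈ Z.toFinset, ℓ j
  have hf : ∀ x, f x = ∑ j ∈ Z.toFinset, ℓ j x := fun x => by
    simp only [f]
    induction Z.toFinset using Finset.induction_on with
    | empty => simp
    | insert k s hk ih => rw [Finset.sum_insert hk, Finset.sum_insert hk, ← ih]; simp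
  have hzero : ∀ x ∈ polyhedron ℓ, (f x = 0 ↔ ∀ j ∈ Z, ℓ j x = 0) := fun x hx => by
    rw [hf, Finset.sum_eq_zero_iff_of_nonneg fun j _ => hx j]
    simp
  have hexp := isExposed_zeros f (P := polyhedron ℓ) fun x hx => by
    rw [hf]
    exact Finset.sum_nonneg fun j _ => hx j
  have hTX : T ∩ {x ∈ polyhedron ℓ | f x = 0} = S := by
    ext x
    rw [hS]
    exact ⟨fun hx => ⟨hx.1, (hzero x hx.2.1).1 hx.2.2⟩,
      fun hx => ⟨hx.1, h.subset hx.1, (hzero x (h.subset hx.1)).2 hx.2⟩⟩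
  have heq : {x ∈ polyhedron ℓ | f x = 0} = convexHull ℝ S := by
    rw [h.polyhedron_eq_convexHull hE] at hexp hTX ⊢
    rw [IsExposed.eq_convexHull hT hexp, hTX]
  rw [heq] at hexp hTX
  refine ⟨⟨hexp, fun hP => ?_⟩, hTX⟩
  obtain ⟨j, hj⟩ := hZ
  obtain ⟨x, hx, hpos⟩ := h.pos j
  have hxS : x ∈ S := by
    rw [← hTX, hP]
    exact ⟨hx, h.subset hx⟩
  exact hpos.ne' (((hS x).1 hxS).2 j hj)

end IsCubicalSystem

end CubicalSystems

/-! ### Coherent orientations as signs of flags -/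

section Flags

/-- A coherent orientation changes its sign between flags that differ in a single cell. -/
lemma IsOrientable.exists_sign {X : Type*} [PartialOrder X] {n : ℕ}
    (h : IsOrientable n (barycentricSubdivision X)) :
    ∃ χ : (Fin (n + 1) → X) → ℤˣ, ∀ s t : Fin (n + 1) → X, StrictMono s → StrictMono t →
      ∀ k, (∀ i, i ≠ k → s i = t i) → s k ≠ t k → χ s = -χ t := by
  classical
  obtain ⟨o, hperm, hadj⟩ := h
  have hface : ∀ s : Fin (n + 1) ↪ X, StrictMono s →
      Finset.univ.map s ∈ (barycentricSubdivision X).faces := by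
    refine fun s hs => ⟨by simp, ?_⟩
    rintro _ hx _ hy -
    simp only [Finset.coe_map, Finset.coe_univ, image_univ, mem_range] at hx hy
    obtain ⟨i, rfl⟩ := hx
    obtain ⟨j, rfl⟩ := hy
    exact (le_total i j).imp (fun h => hs.monotone h) fun h => hs.monotone h
  refine ⟨fun s => if hs : StrictMono s then o ⟨s, hs.injective⟩ else 1,
    fun s t hs ht k hst hk => ?_⟩
  simp only [hs, ht, dif_pos]
  set s' : Fin (n + 1) ↪ X := ⟨s, hs.injective⟩
  set t' : Fin (n + 1) ↪ X := ⟨t, ht.injective⟩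
  -- Coherence is stated for simplices that differ at index 0, so the differing cell is swapped
  -- there; both signs change equally.
  let σ := Equiv.swap 0 k
  have hmap : ∀ u : Fin (n + 1) ↪ X,
      Finset.univ.map (σ.toEmbedding.trans u) = Finset.univ.map u := fun u => by
    rw [← Finset.map_map, Finset.map_univ_equiv]
  have key := hadj (σ.toEmbedding.trans s') (σ.toEmbedding.trans t')
    (by rw [hmap]; exact hface s' hs) (by rw [hmap]; exact hface t' ht)
    (fun i hi => hst _ fun h => hi (by simpa [σ, Equiv.swap_apply_eq_iff] using h))
    (by simpa [σ, s', t'] using hk)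
  rw [hperm s' (hface s' hs), hperm t' (hface t' ht), ← mul_neg] at key
  exact mul_left_cancel key

variable {E : Type*} [AddCommGroup E] [Module ℝ E]

/-- The pair that consists of a cell and the parallel class in it of an edge. -/
def derivedPair (C : Set (Set E)) (e F : Set E) : Set E × Set (Set E) :=
  (F, parallelClass C F e)

lemma parallelClass_mono (C : Set (Set E)) {e F G : Set E} (h : G ⊆ F) :
    parallelClass C G e ⊆ parallelClass C F e :=
  Relation.EqvGen.mono (fun _ _ ⟨Q, hQ, h2, hQG, hrest⟩ => ⟨Q, hQ, h2, hQG.trans h, hrest⟩) e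

lemma parallelClass_congr {C : Set (Set E)} {e e' F : Set E} (h : Opposite C F e e') :
    parallelClass C F e = parallelClass C F e' := by
  have h' := Relation.EqvGen.rel _ _ h
  ext f
  exact ⟨fun hf => .trans _ _ _ (.symm _ _ h') hf, fun hf => .trans _ _ _ h' hf⟩

lemma derivedPair_le {C : Set (Set E)} (e : Set E) {F G : Set E} (h : G ⊆ F) :
    derivedPair C e G ≤ derivedPair C e F := ⟨h, parallelClass_mono C h⟩

lemma derivedPair_lt {C : Set (Set E)} (e : Set E) {F G : Set E} (h : G ⊂ F) :
    derivedPair C e G < derivedPair C e F :=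
  lt_of_le_of_ne (derivedPair_le e h.1) fun heq => h.ne (congrArg Prod.fst heq)

/-- The cell of the derivative complex given by an edge of a cell. -/
def derivedCell {C : Set (Set E)} {e F : Set E} (hF : F ∈ C) (he : IsEdge C e) (h : e ⊆ F) :
    DerivativeComplex C :=
  ⟨derivedPair C e F, hF, e, he, h, rfl⟩

/-- The connected component of a cell of the derivative complex. -/
def component {C : Set (Set E)} (x : DerivativeComplex C) : Set (DerivativeComplex C) :=
  {y | Relation.EqvGen (· ≤ ·) x y}

/-- A raw pair represents a cell in the given set. -/
def Represents {C : Set (Set E)} (M : Set (DerivativeComplex C)) (p : Set E × Set (Set E)) : Prop :=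
  ∃ x ∈ M, (x : Set E × Set (Set E)) = p

lemma represents_of_subset {C : Set (Set E)} {x : DerivativeComplex C} {e F : Set E}
    (he : IsEdge C e) (hF : F ∈ C) (h : e ⊆ F)
    (hx : Represents (component x) (derivedPair C e e)) :
    Represents (component x) (derivedPair C e F) := by
  obtain ⟨y, hy, hye⟩ := hx
  refine ⟨derivedCell hF he h, .trans _ _ _ hy (.rel _ _ ?_), rfl⟩
  show (y : Set E × Set (Set E)) ≤ derivedPair C e F
  rw [hye]
  exact derivedPair_le e h

/-- Opposite edges of `F` define the same cell over `F`, and both edge vertices are faces of it. -/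
lemma represents_of_opposite {C : Set (Set E)} {x : DerivativeComplex C} {e e' F : Set E}
    (hF : F ∈ C) (h : Opposite C F e e')
    (hx : Represents (component x) (derivedPair C e e)) :
    Represents (component x) (derivedPair C e' e') := by
  obtain ⟨Q, hQ, h2, hQF, he, he', heQ, heQ', hd⟩ := id h
  obtain ⟨y, hy, hye⟩ := represents_of_subset he hF (heQ.trans hQF) hx
  refine ⟨derivedCell he'.1 he' subset_rfl, .trans _ _ _ hy (.symm _ _ (.rel _ _ ?_)), rfl⟩
  show derivedPair C e' e' ≤ (y : Set E × Set (Set E))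
  rw [hye, derivedPair, derivedPair, parallelClass_congr h]
  exact derivedPair_le e' (heQ'.trans hQF)

/-- Transfers the sign to sequences of raw pairs, so that later comparisons of flags need no
membership proofs. Sequences that leave `M` get the irrelevant value 1. -/
lemma exists_sign_of_isOrientable {C : Set (Set E)} {M : Set (DerivativeComplex C)} {n : ℕ}
    (h : IsOrientable n (barycentricSubdivision M)) :
    ∃ χ : (Fin (n + 1) → Set E × Set (Set E)) → ℤˣ, ∀ s t : Fin (n + 1) → Set E × Set (Set E),
      StrictMono s → StrictMono t → (∀ i, Represents M (s i)) → (∀ i, Represents M (t i)) →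
      ∀ k, (∀ i, i ≠ k → s i = t i) → s k ≠ t k → χ s = -χ t := by
  classical
  obtain ⟨χ, hχ⟩ := h.exists_sign
  have lift : ∀ s : Fin (n + 1) → Set E × Set (Set E), (∀ i, Represents M (s i)) →
      ∃ s' : Fin (n + 1) → M, ∀ i, ((s' i : DerivativeComplex C) : Set E × Set (Set E)) = s i := by
    intro s hs
    choose f hf hfs using hs
    exact ⟨fun i => ⟨f i, hf i⟩, hfs⟩
  refine ⟨fun s => if hs : ∀ i, Represents M (s i) then χ (lift s hs).choose else 1,
    fun s t hs ht hsM htM k hst hk => ?_⟩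
  simp only [dif_pos hsM, dif_pos htM]
  have hs' := (lift s hsM).choose_spec
  have ht' := (lift t htM).choose_spec
  set s' := (lift s hsM).choose
  set t' := (lift t htM).choose
  refine hχ s' t' (fun i j hij => ?_) (fun i j hij => ?_) k (fun i hi => ?_) fun heq => hk ?_
  · show ((s' i : DerivativeComplex C) : Set E × Set (Set E)) < s' j
    rw [hs', hs']
    exact hs hij
  · show ((t' i : DerivativeComplex C) : Set E × Set (Set E)) < t' j
    rw [ht', ht']
    exact ht hij
  · refine Subtype.ext (Subtype.ext ?_)
    rw [hs', ht', hst i hi]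
  · rw [← hs', ← ht', heq]

lemma sign_eq_of_isChain {α : Type*} {r : α → α → Prop} {P : α → Prop} (c : α → ℤˣ)
    (h : ∀ a b, P a → r a b → P b ∧ c a = -c b) (a : α) (ha : P a) (l : List α)
    (hl : (a :: l).IsChain r) : c a = (-1) ^ l.length * c ((a :: l).getLast (by simp)) := by
  induction l generalizing a with
  | nil => simp
  | cons b l ih =>
    rw [List.isChain_cons_cons] at hl
    obtain ⟨hb, hab⟩ := h a b ha hl.1
    rw [hab, ih b hb hl.2, List.getLast_cons (List.cons_ne_nil b l), List.length_cons, pow_succ,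
      mul_neg_one, neg_mul]

end Flags

/-! ### Integer data of the cubical ball -/

section Ball

/-- Homogeneous coordinates of the vertices of the ball, followed by their scaled heights. -/
def vertexData : List (List ℤ) :=
  [[1, 1, 1, 0, 2], [1, 1, -1, 0, 2], [1, -1, -1, 0, 2], [1, -1, 1, 0, 2], [5, 3, 1, 2, 2],
   [9, 3, 3, 4, 2], [5, 1, 3, 2, 2], [9, 5, 0, 4, 2], [19, 5, 5, 9, 2], [9, 0, 5, 4, 2],
   [21, 1, 1, 10, 22], [13, 1, -1, 6, 14], [5, -1, -1, 2, 6], [13, -1, 1, 6, 14],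
   [25, 3, 1, 12, 22], [29, 3, 3, 14, 22], [25, 1, 3, 12, 22], [25, 5, 0, 12, 18],
   [35, 5, 5, 17, 18], [25, 0, 5, 12, 18], [5, 3, -1, -2, 2], [9, 3, -3, -4, 2],
   [5, 1, -3, -2, 2], [9, 5, 0, -4, 2], [19, 5, -5, -9, 2], [9, 0, -5, -4, 2],
   [21, 1, -1, -10, 22], [13, 1, 1, -6, 14], [5, -1, 1, -2, 6], [13, -1, -1, -6, 14],
   [25, 3, -1, -12, 22], [29, 3, -3, -14, 22], [25, 1, -3, -12, 22], [25, 5, 0, -12, 18],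
   [35, 5, -5, -17, 18], [25, 0, -5, -12, 18]]

/-- The affine functions of the twelve cells and the 34 boundary quadrilaterals of the ball, as
linear functions of the data of a point. -/
def facetData : List (List ℤ) :=
  [[6, -2, -2, -10, -1], [4, -2, 0, -6, -1], [9, -3, -2, -16, -1], [9, -2, -3, -16, -1],
   [4, 0, -2, -6, -1], [2, 0, 0, -2, -1], [6, -2, 2, 10, -1], [4, -2, 0, 6, -1],
   [9, -3, 2, 16, -1], [9, -2, 3, 16, -1], [4, 0, 2, 6, -1], [2, 0, 0, 2, -1],
   [8, 1, 1, -17, 0], [2, -1, -1, -3, 0], [5, -1, 4, -10, 0], [7, 1, 2, -15, 0],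
   [1, -1, 0, -1, 0], [5, -1, 0, -10, 0], [19, 1, 2, -40, 0], [7, -3, -2, -12, 0],
   [5, 0, -1, -10, 0], [19, 2, 1, -40, 0], [7, -2, -3, -12, 0], [5, 4, -1, -10, 0],
   [7, 2, 1, -15, 0], [1, 0, -1, -1, 0], [1, 0, 1, -2, 0], [1, 1, 0, -2, 0], [6, 2, 2, -13, 0],
   [8, 1, -1, 17, 0], [2, -1, 1, 3, 0], [5, -1, -4, 10, 0], [7, 1, -2, 15, 0],
   [1, -1, 0, 1, 0], [5, -1, 0, 10, 0], [19, 1, -2, 40, 0], [7, -3, 2, 12, 0],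
   [5, 0, 1, 10, 0], [19, 2, -1, 40, 0], [7, -2, 3, 12, 0], [5, 4, 1, 10, 0],
   [7, 2, -1, 15, 0], [1, 0, 1, 1, 0], [1, 0, -1, 2, 0], [1, 1, 0, 2, 0], [6, 2, -2, 13, 0]]

/-- The vertices of the twelve cells and the 34 boundary quadrilaterals, in the order of the
vertices of a standard cube. -/
def incidenceData : List (List ℕ) :=
  [[10, 0, 16, 6, 14, 4, 15, 5], [10, 0, 11, 1, 14, 4, 17, 7], [14, 4, 17, 7, 15, 5, 18, 8],
   [15, 5, 18, 8, 16, 6, 19, 9], [16, 6, 19, 9, 10, 0, 13, 3], [10, 0, 13, 3, 11, 1, 12, 2],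
   [26, 1, 32, 22, 30, 20, 31, 21], [26, 1, 27, 0, 30, 20, 33, 23],
   [30, 20, 33, 23, 31, 21, 34, 24], [31, 21, 34, 24, 32, 22, 35, 25],
   [32, 22, 35, 25, 26, 1, 29, 2], [26, 1, 29, 2, 27, 0, 28, 3], [10, 16, 14, 15],
   [0, 6, 4, 5], [11, 1, 17, 7], [10, 11, 14, 17], [0, 1, 4, 7], [17, 7, 18, 8],
   [14, 17, 15, 18], [4, 7, 5, 8], [18, 8, 19, 9], [15, 18, 16, 19], [5, 8, 6, 9],
   [19, 9, 13, 3], [16, 19, 10, 13], [6, 9, 0, 3], [11, 1, 12, 2], [13, 3, 12, 2],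
   [10, 13, 11, 12], [26, 32, 30, 31], [1, 22, 20, 21], [27, 0, 33, 23], [26, 27, 30, 33],
   [1, 0, 20, 23], [33, 23, 34, 24], [30, 33, 31, 34], [20, 23, 21, 24], [34, 24, 35, 25],
   [31, 34, 32, 35], [21, 24, 22, 25], [35, 25, 29, 2], [32, 35, 26, 29], [22, 25, 1, 2],
   [27, 0, 28, 3], [29, 2, 28, 3], [26, 29, 27, 28]]

/-- The neighbors of the cells and boundary quadrilaterals across their facets. -/
def neighborData : List (List ℕ) :=
  [[4, 2, 1, 3, 12, 13], [5, 2, 0, 14, 15, 16], [1, 3, 0, 17, 18, 19], [2, 4, 0, 20, 21, 22],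
   [3, 5, 0, 23, 24, 25], [4, 26, 1, 27, 28, 11], [10, 8, 7, 9, 29, 30],
   [11, 8, 6, 31, 32, 33], [7, 9, 6, 34, 35, 36], [8, 10, 6, 37, 38, 39],
   [9, 11, 6, 40, 41, 42], [10, 43, 7, 44, 45, 5], [24, 18, 15, 21], [25, 19, 16, 22],
   [26, 17, 15, 16], [28, 18, 12, 14], [33, 19, 13, 14], [14, 20, 18, 19], [15, 21, 12, 17],
   [16, 22, 13, 17], [17, 23, 21, 22], [18, 24, 12, 20], [19, 25, 13, 20], [20, 27, 24, 25],
   [21, 28, 12, 23], [22, 43, 13, 23], [14, 27, 28, 42], [23, 26, 28, 44], [24, 26, 15, 27],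
   [41, 35, 32, 38], [42, 36, 33, 39], [43, 34, 32, 33], [45, 35, 29, 31], [16, 36, 30, 31],
   [31, 37, 35, 36], [32, 38, 29, 34], [33, 39, 30, 34], [34, 40, 38, 39], [35, 41, 29, 37],
   [36, 42, 30, 37], [37, 44, 41, 42], [38, 45, 29, 40], [39, 26, 30, 40], [31, 44, 45, 25],
   [40, 43, 45, 27], [41, 43, 32, 44]]

/-- The cells that contain the boundary quadrilaterals. -/
def boundaryCellData : List ℕ :=
  [0, 0, 1, 1, 1, 2, 2, 2, 3, 3, 3, 4, 4, 4, 5, 5, 5, 6, 6, 7, 7, 7, 8, 8, 8, 9, 9, 9, 10, 10,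
    10, 11, 11, 11]

/-- The data of a vertex. -/
def hat (v : Fin 36) (k : Fin 5) : ℤ := (vertexData.getD v []).getD k 0

/-- The coefficients of the affine function of a cell or boundary quadrilateral. -/
def coef (j : Fin 46) (k : Fin 5) : ℤ := (facetData.getD j []).getD k 0

/-- The value of an affine function at a vertex, up to a positive factor; for a cell, the height of
the vertex is subtracted. -/
def slack (j : Fin 46) (v : Fin 36) : ℤ :=
  coef j 0 * hat v 0 + coef j 1 * hat v 1 + coef j 2 * hat v 2 + coef j 3 * hat v 3 +
    coef j 4 * hat v 4

/-- The vertices of a cell. -/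
def cellVertex (c : Fin 46) (s₀ s₁ s₂ : Bool) : Fin 36 :=
  Fin.ofNat 36 ((incidenceData.getD c []).getD (4 * s₀.toNat + 2 * s₁.toNat + s₂.toNat) 0)

/-- The vertices of a boundary quadrilateral. -/
def quadVertex (c : Fin 46) (s₀ s₁ : Bool) : Fin 36 :=
  Fin.ofNat 36 ((incidenceData.getD c []).getD (2 * s₀.toNat + s₁.toNat) 0)

/-- The neighbor of a cell or boundary quadrilateral across one of its facets. -/
def neighbor (c : Fin 46) (i : ℕ) (b : Bool) : Fin 46 :=
  Fin.ofNat 46 ((neighborData.getD c []).getD (2 * i + b.toNat) 0)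

/-- The cell that contains a boundary quadrilateral. -/
def boundaryCell (j : Fin 46) : Fin 46 := Fin.ofNat 46 (boundaryCellData.getD (j - 12) 0)

/-- This is the regularity of the subdivision: each cell's affine function lies above the height at
every vertex, and all vertices satisfy the boundary inequalities. -/
lemma slack_nonneg : ∀ j v, 0 ≤ slack j v := by decide +kernel

lemma exists_slack_pos : ∀ j, ∃ v, 0 < slack j v := by decide +kernel

lemma hat_zero_pos : ∀ v, 0 < hat v 0 := by decide +kernel

lemma hat_four_pos : ∀ v, 0 < hat v 4 := by decide +kernel

lemma coef_four_of_lt : ∀ j : Fin 46, j < 12 → coef j 4 = -1 := by decide +kernel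

lemma coef_four_of_ge : ∀ j : Fin 46, 12 ≤ j → coef j 4 = 0 := by decide +kernel

lemma slack_cellVertex : ∀ c : Fin 46, c < 12 → ∀ s₀ s₁ s₂,
    slack c (cellVertex c s₀ s₁ s₂) = 0 := by
  decide +kernel

lemma slack_neighbor_cellVertex : ∀ c : Fin 46, c < 12 → ∀ s₀ s₁ s₂ b (i : Fin 3),
    slack (neighbor c i b) (cellVertex c s₀ s₁ s₂) = 0 ↔ ![s₀, s₁, s₂] i = b := by
  decide +kernel

lemma slack_quadVertex : ∀ c : Fin 46, 12 ≤ c → ∀ s₀ s₁, slack c (quadVertex c s₀ s₁) = 0 ∧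
    slack (boundaryCell c) (quadVertex c s₀ s₁) = 0 := by
  decide +kernel

lemma slack_neighbor_quadVertex : ∀ c : Fin 46, 12 ≤ c → ∀ s₀ s₁ b (i : Fin 2),
    slack (neighbor c i b) (quadVertex c s₀ s₁) = 0 ↔ ![s₀, s₁] i = b := by
  decide +kernel

lemma le_neighbor_of_ge : ∀ c : Fin 46, 12 ≤ c → ∀ b (i : Fin 2), 12 ≤ neighbor c i b := by
  decide +kernel

lemma boundaryCell_lt : ∀ c : Fin 46, 12 ≤ c → boundaryCell c < 12 := by decide +kernel

end Ball

/-! ### The Möbius strip and a closed walk of flags -/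

section BallWalk

/-- The vertices at which an affine function of the ball vanishes. -/
def zeroSet (j : Fin 46) : Finset (Fin 36) := Finset.univ.filter fun v => slack j v = 0

/-- The vertex sets of the faces of the ball: those that contain every common zero of the affine
functions that vanish on them. -/
def IsBallFace (S : Finset (Fin 36)) : Prop :=
  S.Nonempty ∧ ∀ v, (∀ j, (∀ u ∈ S, slack j u = 0) → slack j v = 0) → v ∈ S

instance (S : Finset (Fin 36)) : Decidable (IsBallFace S) := inferInstanceAs (Decidable (_ ∧ _))

/-- An edge, a quadrilateral and a cell of the ball. -/
structure BallFlag where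
  /-- The vertices of the edge. -/
  e : Finset (Fin 36)
  /-- The vertices of the quadrilateral. -/
  q : Finset (Fin 36)
  /-- The cell. -/
  c : Fin 46

/-- The edge, the quadrilateral and the cell are faces of the ball, each a proper face of the
next. -/
def BallFlag.IsValid (f : BallFlag) : Prop :=
  f.e.card = 2 ∧ IsBallFace f.e ∧ IsBallFace f.q ∧ f.e ⊂ f.q ∧ f.q ⊂ zeroSet f.c ∧
    f.c < 12

instance (f : BallFlag) : Decidable f.IsValid := inferInstanceAs (Decidable (_ ∧ _))

/-- Four vertices of a quadrilateral with the opposite edges `p₀p₁` and `p₂p₃`, and the coefficients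
of a linear dependence between their homogeneous coordinates. -/
structure Strip where
  /-- The first vertex of the first edge. -/
  p₀ : Fin 36
  /-- The second vertex of the first edge. -/
  p₁ : Fin 36
  /-- The first vertex of the second edge. -/
  p₂ : Fin 36
  /-- The second vertex of the second edge. -/
  p₃ : Fin 36
  /-- The coefficient of `p₀`. -/
  a₀ : ℤ
  /-- The coefficient of `p₁`. -/
  a₁ : ℤ
  /-- The coefficient of `p₂`. -/
  a₂ : ℤ
  /-- The coefficient of `p₃`. -/
  a₃ : ℤ

/-- The quadrilaterals of a Möbius strip in the ball. -/
def moebiusStrip : List Strip :=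
  [⟨0, 1, 4, 7, 3, -1, -4, 2⟩,
   ⟨4, 7, 5, 8, 5, -2, -5, 2⟩,
   ⟨5, 8, 6, 9, 5, -2, -5, 2⟩,
   ⟨6, 9, 0, 3, 4, -2, -3, 1⟩,
   ⟨0, 3, 1, 2, 1, -1, -1, 1⟩,
   ⟨1, 2, 22, 25, 3, -1, -4, 2⟩,
   ⟨22, 25, 21, 24, 5, -2, -5, 2⟩,
   ⟨21, 24, 20, 23, 5, -2, -5, 2⟩,
   ⟨20, 23, 1, 0, 4, -2, -3, 1⟩]

/-- The vertices of the first edge. -/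
def Strip.fst (p : Strip) : Finset (Fin 36) := {p.p₀, p.p₁}

/-- The vertices of the second edge. -/
def Strip.snd (p : Strip) : Finset (Fin 36) := {p.p₂, p.p₃}

/-- The vertices of the quadrilateral. -/
def Strip.quad (p : Strip) : Finset (Fin 36) := {p.p₀, p.p₁, p.p₂, p.p₃}

/-- The dependence includes the height coordinate, so the quadrilaterals stay planar when lifted to
the polytope. -/
lemma moebiusStrip_dependent : ∀ p ∈ moebiusStrip, p.a₃ ≠ 0 ∧ ∀ k,
    p.a₀ * hat p.p₀ k + p.a₁ * hat p.p₁ k + p.a₂ * hat p.p₂ k + p.a₃ * hat p.p₃ k = 0 := by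
  decide +kernel

lemma moebiusStrip_opposite : ∀ p ∈ moebiusStrip, ∃ j, slack j p.p₀ = 0 ∧ slack j p.p₁ = 0 ∧
    slack j p.p₂ ≠ 0 ∧ slack j p.p₃ ≠ 0 := by
  decide +kernel

lemma moebiusStrip_adjacent : ∀ p ∈ moebiusStrip, ∃ j, slack j p.p₀ = 0 ∧ slack j p.p₂ = 0 ∧
    slack j p.p₁ ≠ 0 := by
  decide +kernel

lemma moebiusStrip_card : ∀ p ∈ moebiusStrip, p.snd.card = 2 ∧ p.fst.card = 2 ∧ p.fst ≠ p.snd := by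
  decide +kernel

/-- Two flags of the ball are adjacent if they differ in a single cell; a change of the edge has to
be one to the opposite edge in a quadrilateral of the Möbius strip. -/
def BallFlag.Step (f g : BallFlag) : Prop :=
  g.IsValid ∧
    ((f.q = g.q ∧ f.c = g.c ∧ ∃ p ∈ moebiusStrip, f.e = p.fst ∧ g.e = p.snd ∧ f.q = p.quad) ∨
      (f.e = g.e ∧ f.c = g.c ∧ f.q ≠ g.q) ∨ (f.e = g.e ∧ f.q = g.q ∧ zeroSet f.c ≠ zeroSet g.c))

instance (f g : BallFlag) : Decidable (f.Step g) := inferInstanceAs (Decidable (_ ∧ _))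

/-- The first flag of a closed walk along the Möbius strip. -/
def walkStart : BallFlag := ⟨{0, 1}, {0, 1, 4, 7}, 1⟩

/-- The other flags of a closed walk along the Möbius strip. -/
def walkData : List BallFlag :=
  [⟨{4, 7}, {0, 1, 4, 7}, 1⟩, ⟨{4, 7}, {4, 7, 14, 17}, 1⟩,
   ⟨{4, 7}, {4, 7, 14, 17}, 2⟩, ⟨{4, 7}, {4, 5, 7, 8}, 2⟩, ⟨{5, 8}, {4, 5, 7, 8}, 2⟩,
   ⟨{5, 8}, {5, 8, 15, 18}, 2⟩, ⟨{5, 8}, {5, 8, 15, 18}, 3⟩, ⟨{5, 8}, {5, 6, 8, 9}, 3⟩,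
   ⟨{6, 9}, {5, 6, 8, 9}, 3⟩, ⟨{6, 9}, {6, 9, 16, 19}, 3⟩, ⟨{6, 9}, {6, 9, 16, 19}, 4⟩,
   ⟨{6, 9}, {0, 3, 6, 9}, 4⟩, ⟨{0, 3}, {0, 3, 6, 9}, 4⟩, ⟨{0, 3}, {0, 3, 10, 13}, 4⟩,
   ⟨{0, 3}, {0, 3, 10, 13}, 5⟩, ⟨{0, 3}, {0, 1, 2, 3}, 5⟩, ⟨{1, 2}, {0, 1, 2, 3}, 5⟩,
   ⟨{1, 2}, {0, 1, 2, 3}, 11⟩, ⟨{1, 2}, {1, 2, 26, 29}, 11⟩, ⟨{1, 2}, {1, 2, 26, 29}, 10⟩,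
   ⟨{1, 2}, {1, 2, 22, 25}, 10⟩, ⟨{22, 25}, {1, 2, 22, 25}, 10⟩,
   ⟨{22, 25}, {22, 25, 32, 35}, 10⟩, ⟨{22, 25}, {22, 25, 32, 35}, 9⟩,
   ⟨{22, 25}, {21, 22, 24, 25}, 9⟩, ⟨{21, 24}, {21, 22, 24, 25}, 9⟩,
   ⟨{21, 24}, {21, 24, 31, 34}, 9⟩, ⟨{21, 24}, {21, 24, 31, 34}, 8⟩,
   ⟨{21, 24}, {20, 21, 23, 24}, 8⟩, ⟨{20, 23}, {20, 21, 23, 24}, 8⟩,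
   ⟨{20, 23}, {20, 23, 30, 33}, 8⟩, ⟨{20, 23}, {20, 23, 30, 33}, 7⟩,
   ⟨{20, 23}, {0, 1, 20, 23}, 7⟩, ⟨{0, 1}, {0, 1, 20, 23}, 7⟩, ⟨{0, 1}, {0, 1, 26, 27}, 7⟩,
   ⟨{0, 1}, {0, 1, 26, 27}, 11⟩, ⟨{0, 1}, {0, 1, 2, 3}, 11⟩, ⟨{0, 1}, {0, 1, 2, 3}, 5⟩,
   ⟨{0, 1}, {0, 1, 10, 11}, 5⟩, ⟨{0, 1}, {0, 1, 10, 11}, 1⟩, ⟨{0, 1}, {0, 1, 4, 7}, 1⟩]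

lemma isValid_walkStart : walkStart.IsValid := by decide +kernel

lemma isChain_walk : (walkStart :: walkData).IsChain BallFlag.Step := by decide +kernel

lemma getLast_walk : (walkStart :: walkData).getLast (by simp) = walkStart := rfl

lemma length_walk : walkData.length = 41 := rfl

lemma isBallFace_zeroSet {j : Fin 46} (h : (zeroSet j).Nonempty) : IsBallFace (zeroSet j) :=
  ⟨h, fun v hv => by simpa [zeroSet] using hv j fun u hu => by simpa [zeroSet] using hu⟩

lemma hat_injective : ∀ v w, (∀ k : Fin 3, hat v k.succ.castSucc * hat w 0 =
    hat w k.succ.castSucc * hat v 0) → v = w := by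
  decide +kernel

end BallWalk

/-! ### The polytope over the ball and its faces -/

section FiberedPolytope

variable {m : ℕ} {E : Type*} [NormedAddCommGroup E] [NormedSpace ℝ E]
  (Φ : ((Fin 3 → ℝ) × (Fin m → ℝ)) ≃ₗ[ℝ] E)

/-- The sign of a vertex coordinate of the cube `[-1,1]^m`. -/
def boolSign (b : Bool) : ℝ := if b then 1 else -1

/-- The vertex of the polytope over the vertex `v` of the ball in the fiber direction `t`. -/
noncomputable def fiberPoint (v : Fin 36) (t : Fin m → Bool) : E :=
  Φ (fun k => (hat v k.succ.castSucc : ℝ) / hat v 0,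
    fun i => boolSign (t i) * (hat v 4 / hat v 0))

/-- The inequalities of the polytope: those of the boundary quadrilaterals of the ball, and for
every cell those that bound the fiber coordinates by the height function of the cell. -/
noncomputable def fiberFacet (j : Fin 46 × Fin m × Bool) : E →ᵃ[ℝ] ℝ :=
  AffineMap.const ℝ E (coef j.1 0 : ℝ) +
    (((coef j.1 1 : ℝ) • (LinearMap.proj 0 ∘ₗ LinearMap.fst ℝ (Fin 3 → ℝ) (Fin m → ℝ)) +
      (coef j.1 2 : ℝ) • (LinearMap.proj 1 ∘ₗ LinearMap.fst ℝ (Fin 3 → ℝ) (Fin m → ℝ)) +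
      (coef j.1 3 : ℝ) • (LinearMap.proj 2 ∘ₗ LinearMap.fst ℝ (Fin 3 → ℝ) (Fin m → ℝ)) +
      (coef j.1 4 * boolSign j.2.2 : ℝ) •
        (LinearMap.proj j.2.1 ∘ₗ LinearMap.snd ℝ (Fin 3 → ℝ) (Fin m → ℝ))) ∘ₗ
      (Φ.symm : E →ₗ[ℝ] _)).toAffineMap

lemma hat_zero_pos' (v : Fin 36) : (0 : ℝ) < hat v 0 := by exact_mod_cast hat_zero_pos v

/-- If `t` disagrees with the sign of the inequality, the height term of the slack is reversed,
which costs twice that term. -/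
lemma fiberFacet_fiberPoint (j : Fin 46 × Fin m × Bool) (v : Fin 36) (t : Fin m → Bool) :
    fiberFacet Φ j (fiberPoint Φ v t) =
      ((slack j.1 v - if t j.2.1 = j.2.2 then 0 else 2 * coef j.1 4 * hat v 4 : ℤ) : ℝ) /
        hat v 0 := by
  obtain ⟨j, i, σ⟩ := j
  have h0 := (hat_zero_pos' v).ne'
  have e : boolSign σ * boolSign (t i) = if t i = σ then 1 else -1 := by
    cases σ <;> cases t i <;> simp [boolSign]
  have key : fiberFacet Φ (j, i, σ) (fiberPoint Φ v t) =
      (coef j 0 * hat v 0 + coef j 1 * hat v 1 + coef j 2 * hat v 2 + coef j 3 * hat v 3 +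
        coef j 4 * hat v 4 * (boolSign σ * boolSign (t i))) / hat v 0 := by
    have h1 : (0 : Fin 3).succ.castSucc = (1 : Fin 5) := rfl
    have h2 : (1 : Fin 3).succ.castSucc = (2 : Fin 5) := rfl
    have h3 : (2 : Fin 3).succ.castSucc = (3 : Fin 5) := rfl
    simp only [fiberFacet, fiberPoint, AffineMap.coe_add, Pi.add_apply, AffineMap.const_apply,
      LinearMap.coe_toAffineMap, LinearMap.comp_apply, LinearEquiv.coe_coe,
      LinearEquiv.symm_apply_apply, LinearMap.add_apply, LinearMap.smul_apply, LinearMap.fst_apply,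
      LinearMap.snd_apply, LinearMap.proj_apply, smul_eq_mul, h1, h2, h3]
    field_simp
    ring
  rw [key, e]
  congr 1
  simp only [slack]
  split_ifs <;> push_cast <;> ring

lemma fiberFacet_nonneg (j : Fin 46 × Fin m × Bool) (v : Fin 36) (t : Fin m → Bool) :
    0 ≤ fiberFacet Φ j (fiberPoint Φ v t) := by
  rw [fiberFacet_fiberPoint]
  refine div_nonneg ?_ (hat_zero_pos' v).le
  have h1 := slack_nonneg j.1 v
  have h2 := hat_four_pos v
  rcases lt_or_ge j.1 12 with h | h
  · have h3 := coef_four_of_lt _ h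
    rw [h3]
    exact_mod_cast (by split_ifs <;> omega : (0 : ℤ) ≤ _)
  · have h3 := coef_four_of_ge _ h
    rw [h3]
    exact_mod_cast (by split_ifs <;> omega : (0 : ℤ) ≤ _)

lemma fiberFacet_eq_zero_iff (j : Fin 46 × Fin m × Bool) (v : Fin 36) (t : Fin m → Bool) :
    fiberFacet Φ j (fiberPoint Φ v t) = 0 ↔ slack j.1 v = 0 ∧ (t j.2.1 = j.2.2 ∨ 12 ≤ j.1) := by
  rw [fiberFacet_fiberPoint, div_eq_zero_iff, or_iff_left (hat_zero_pos' v).ne', Int.cast_eq_zero]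
  have h1 := slack_nonneg j.1 v
  have h2 := hat_four_pos v
  rcases lt_or_ge j.1 12 with h | h
  · rw [coef_four_of_lt _ h, or_iff_left (not_le.2 h)]
    split_ifs with h4
    · simp [h4]
    · simp only [h4, and_false, iff_false]
      omega
  · rw [coef_four_of_ge _ h]
    simp [h]

/-- The vertices of the polytope. -/
def fiberVertices : Set E := range fun p : Fin 36 × (Fin m → Bool) => fiberPoint Φ p.1 p.2

lemma finite_fiberVertices : (fiberVertices Φ).Finite := finite_range _

lemma isCubicalSystem_fiberFacet [FiniteDimensional ℝ E] :
    IsCubicalSystem (fiberFacet Φ) (fiberVertices Φ) where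
  subset := by
    rintro _ ⟨⟨v, t⟩, rfl⟩ j
    exact fiberFacet_nonneg Φ j v t
  pos := by
    intro j
    obtain ⟨v, hv⟩ := exists_slack_pos j.1
    refine ⟨_, ⟨(v, fun _ => true), rfl⟩, (fiberFacet_nonneg Φ j v _).lt_of_ne' fun h => ?_⟩
    exact hv.ne' ((fiberFacet_eq_zero_iff Φ j v _).1 h).1
  facet := by
    classical
    have hfin : finrank ℝ E = 3 + m := by
      rw [← Φ.finrank_eq]
      simp
    rintro ⟨c, i, σ⟩
    rcases lt_or_ge c 12 with hc | hc
    -- A facet over a cell: `y i` is fixed at `± g`, and the other fiber coordinates are free. Its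
    -- facets come from neighbors in the ball or from a second fiber coordinate reaching its bound
    -- over the same cell.
    · refine ⟨Fin 3 ⊕ {j : Fin m // j ≠ i}, inferInstance,
        fun s => fiberPoint Φ (cellVertex c (s (.inl 0)) (s (.inl 1)) (s (.inl 2)))
          (extendAt i σ fun j => s (.inr j)),
        Sum.elim (fun a b => (neighbor c a.val b, i, σ)) (fun j b => (c, j.val, b)),
        ?_, fun s => ⟨(_, _), rfl⟩, fun s => ?_, ?_⟩
      · have : 0 < m := i.pos
        simp only [Fintype.card_sum, Fintype.card_fin, Fintype.card_subtype_compl,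
          Fintype.card_unique, ne_eq, hfin]
        omega
      · rw [fiberFacet_eq_zero_iff]
        exact ⟨slack_cellVertex c hc _ _ _, .inl (by simp)⟩
      · rintro (a | j) b s
        · simp only [Sum.elim_inl, fiberFacet_eq_zero_iff, slack_neighbor_cellVertex c hc,
            extendAt_self, true_or, and_true]
          fin_cases a <;> rfl
        · simp [fiberFacet_eq_zero_iff, slack_cellVertex c hc, hc.not_ge]
    -- A facet over a boundary quadrilateral: here `coef c 4 = 0`, so `i` and `σ` play no role and
    -- all fiber coordinates are free. Their bounds come from the cell containing the quadrilateral.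
    · refine ⟨Fin 2 ⊕ Fin m, inferInstance,
        fun s => fiberPoint Φ (quadVertex c (s (.inl 0)) (s (.inl 1))) (fun j => s (.inr j)),
        Sum.elim (fun a b => (neighbor c a.val b, i, σ)) (fun j b => (boundaryCell c, j, b)),
        ?_, fun s => ⟨(_, _), rfl⟩, fun s => ?_, ?_⟩
      · simp only [Fintype.card_sum, Fintype.card_fin, hfin]
        omega
      · rw [fiberFacet_eq_zero_iff]
        exact ⟨(slack_quadVertex c hc _ _).1, .inr hc⟩
      · rintro (a | j) b s
        · simp only [Sum.elim_inl, fiberFacet_eq_zero_iff, slack_neighbor_quadVertex c hc,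
            le_neighbor_of_ge c hc, or_true, and_true]
          fin_cases a <;> rfl
        · simp [fiberFacet_eq_zero_iff, (slack_quadVertex c hc _ _).2, boundaryCell_lt c hc]

/-- The vertices of a face of the polytope over a face of the ball: the first fiber coordinate and
those after the `r`-th are fixed to be positive. -/
def faceVertices (S : Finset (Fin 36)) (r : ℕ) : Set E :=
  {x | ∃ v ∈ S, ∃ t : Fin m → Bool, (∀ i : Fin m, i.val = 0 ∨ r < i.val → t i = true) ∧
    x = fiberPoint Φ v t}

/-- A face of the polytope over a face of the ball. -/
def fiberFace (S : Finset (Fin 36)) (r : ℕ) : Set E := convexHull ℝ (faceVertices Φ S r)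

/-- A face of the ball that is contained in a cell. -/
def IsInnerFace (S : Finset (Fin 36)) : Prop :=
  IsBallFace S ∧ ∃ c : Fin 46, c < 12 ∧ S ⊆ zeroSet c

variable [NeZero m] {S S' : Finset (Fin 36)} {r r' : ℕ}

/-- Closedness of `S` recovers membership of `v`; the inequalities of a cell containing `S` detect
the signs of the fixed fiber coordinates. -/
lemma fiberFacet_eq_zero_forall_iff (hS : IsInnerFace S) (v : Fin 36) (t : Fin m → Bool) :
    (∀ j ∈ {j : Fin 46 × Fin m × Bool | (∀ u ∈ S, slack j.1 u = 0) ∧ j.2.2 = true ∧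
        (j.2.1.val = 0 ∨ r < j.2.1.val)}, fiberFacet Φ j (fiberPoint Φ v t) = 0) ↔
      v ∈ S ∧ ∀ i : Fin m, i.val = 0 ∨ r < i.val → t i = true := by
  simp only [fiberFacet_eq_zero_iff]
  obtain ⟨hSf, c, hc, hSc⟩ := hS
  constructor
  · intro h
    refine ⟨hSf.2 v fun j hj => (h (j, 0, true) ⟨hj, rfl, .inl (by simp)⟩).1, fun i hi => ?_⟩
    have := (h (c, i, true) ⟨fun u hu => by simpa [zeroSet] using hSc hu, rfl, hi⟩).2
    simpa [hc.not_ge] using this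
  · rintro ⟨hv, ht⟩ ⟨j, i, σ⟩ ⟨hj, hσ, hi⟩
    exact ⟨hj v hv, .inl ((ht i hi).trans hσ.symm)⟩

lemma mem_faceVertices_iff (hS : IsInnerFace S) (x : E) :
    x ∈ faceVertices Φ S r ↔ x ∈ fiberVertices Φ ∧
      ∀ j ∈ {j : Fin 46 × Fin m × Bool | (∀ u ∈ S, slack j.1 u = 0) ∧ j.2.2 = true ∧
        (j.2.1.val = 0 ∨ r < j.2.1.val)}, fiberFacet Φ j x = 0 := by
  constructor
  · rintro ⟨v, hv, t, ht, rfl⟩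
    exact ⟨⟨(v, t), rfl⟩, (fiberFacet_eq_zero_forall_iff Φ hS v t).2 ⟨hv, ht⟩⟩
  · rintro ⟨⟨⟨v, t⟩, rfl⟩, h⟩
    obtain ⟨hv, ht⟩ := (fiberFacet_eq_zero_forall_iff Φ hS v t).1 h
    exact ⟨v, hv, t, ht, rfl⟩

lemma fiberPoint_mem_faceVertices_iff (hS : IsInnerFace S) (v : Fin 36) (t : Fin m → Bool) :
    fiberPoint Φ v t ∈ faceVertices Φ S r ↔
      v ∈ S ∧ ∀ i : Fin m, i.val = 0 ∨ r < i.val → t i = true := by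
  rw [mem_faceVertices_iff Φ hS, fiberFacet_eq_zero_forall_iff Φ hS,
    and_iff_right (show _ ∈ fiberVertices Φ from ⟨(v, t), rfl⟩)]

lemma fiberFace_mem [FiniteDimensional ℝ E] (hS : IsInnerFace S) (r : ℕ) :
    fiberFace Φ S r ∈ boundaryComplex (polyhedron (fiberFacet Φ)) ∧
      fiberVertices Φ ∩ fiberFace Φ S r = faceVertices Φ S r := by
  have hfin : finrank ℝ E = 3 + m := by
    rw [← Φ.finrank_eq]
    simp
  refine (isCubicalSystem_fiberFacet Φ).convexHull_mem_boundaryComplex (finite_fiberVertices Φ)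
    (by omega) ?_ (mem_faceVertices_iff Φ hS)
  obtain ⟨-, c, hc, hSc⟩ := hS
  -- The fiber coordinate 0 is never freed, which supplies a tight inequality and keeps the face
  -- proper.
  exact ⟨(c, 0, true), fun u hu => by simpa [zeroSet] using hSc hu, rfl, .inl (by simp)⟩

lemma fiberFace_injective [FiniteDimensional ℝ E] (hS : IsInnerFace S) (hS' : IsInnerFace S')
    (hr : r < m) (hr' : r' < m) (h : fiberFace Φ S r = fiberFace Φ S' r') : S = S' ∧ r = r' := by
  have hV : faceVertices Φ S r = faceVertices Φ S' r' := by
    rw [← (fiberFace_mem Φ hS r).2, ← (fiberFace_mem Φ hS' r').2, h]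
  have key : ∀ (v : Fin 36) (t : Fin m → Bool),
      (v ∈ S ∧ ∀ i : Fin m, i.val = 0 ∨ r < i.val → t i = true) ↔
      (v ∈ S' ∧ ∀ i : Fin m, i.val = 0 ∨ r' < i.val → t i = true) := fun v t => by
    rw [← fiberPoint_mem_faceVertices_iff Φ hS, ← fiberPoint_mem_faceVertices_iff Φ hS', hV]
  have hSS : S = S' := by
    ext v
    simpa using key v fun _ => true
  subst hSS
  refine ⟨rfl, ?_⟩
  obtain ⟨v, hv⟩ := hS.1.1
  have key' : ∀ a b, a < m → b < m → (∀ t : Fin m → Bool,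
      (∀ i : Fin m, i.val = 0 ∨ b < i.val → t i = true) →
        ∀ i : Fin m, i.val = 0 ∨ a < i.val → t i = true) → b ≤ a := by
    intro a b _ hb h
    by_contra! hab
    -- The sign vector negative only at `b` is allowed when coordinates up to `b` are free, but not
    -- when `b` is fixed.
    have := h (fun i => decide (i.val ≠ b)) (fun i hi => by simp; omega) ⟨b, hb⟩ (.inr hab)
    simp at this
  exact le_antisymm (key' _ _ hr' hr fun t ht => ((key v t).1 ⟨hv, ht⟩).2)
    (key' _ _ hr hr' fun t ht => ((key v t).2 ⟨hv, ht⟩).2)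

omit [NeZero m] in
lemma fiberFace_mono (hS : S ⊆ S') (hr : r ≤ r') : fiberFace Φ S r ⊆ fiberFace Φ S' r' := by
  refine convexHull_mono ?_
  rintro _ ⟨v, hv, t, ht, rfl⟩
  exact ⟨v, hS hv, t, fun i hi => ht i (hi.imp_right hr.trans_lt), rfl⟩

lemma fiberFace_ssubset [FiniteDimensional ℝ E] (hS : IsInnerFace S) (hS' : IsInnerFace S')
    (hr : r < m) (hr' : r' < m) (h : (S, r) < (S', r')) : fiberFace Φ S r ⊂ fiberFace Φ S' r' := by
  refine (fiberFace_mono Φ h.le.1 h.le.2).ssubset_of_ne fun heq => h.ne ?_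
  obtain ⟨h1, h2⟩ := fiberFace_injective Φ hS hS' hr hr' heq
  rw [h1, h2]

omit [NeZero m] in
lemma fiberFace_zero (S : Finset (Fin 36)) :
    fiberFace Φ S 0 = convexHull ℝ ((fun v => fiberPoint Φ v fun _ => true) '' S) := by
  refine congrArg (convexHull ℝ) (ext fun x => ?_)
  constructor
  · rintro ⟨v, hv, t, ht, rfl⟩
    refine ⟨v, hv, congrArg (fiberPoint Φ v) (funext fun i => ?_)⟩
    exact (ht i (Nat.eq_zero_or_pos _)).symm
  · rintro ⟨v, hv, rfl⟩
    exact ⟨v, hv, _, fun _ _ => rfl, rfl⟩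

omit [NeZero m] in
lemma fiberPoint_injective {v w : Fin 36} {t : Fin m → Bool}
    (h : fiberPoint Φ v t = fiberPoint Φ w t) : v = w := by
  have h' := Φ.injective h
  rw [Prod.mk.injEq] at h'
  have h0 := (hat_zero_pos' v).ne'
  have h0' := (hat_zero_pos' w).ne'
  refine hat_injective v w fun k => ?_
  have := congrFun h'.1 k
  rw [div_eq_div_iff h0 h0'] at this
  exact_mod_cast this

end FiberedPolytope

/-! ### Dimensions of segments and quadrilaterals -/

section Dimension

variable {E : Type*} [AddCommGroup E] [Module ℝ E]

lemma vectorSpan_convexHull (s : Set E) : vectorSpan ℝ (convexHull ℝ s) = vectorSpan ℝ s := by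
  rw [← direction_affineSpan, affineSpan_convexHull, direction_affineSpan]

lemma dim_segment {p q : E} (h : p ≠ q) : dim (convexHull ℝ {p, q}) = 1 := by
  rw [dim, vectorSpan_convexHull, vectorSpan_eq_span_vsub_set_right ℝ (mem_insert p {q})]
  have : (fun x => x -ᵥ p) '' ({p, q} : Set E) = {0, q - p} := by
    simp [image_insert_eq]
  rw [this, Submodule.span_insert_zero, finrank_span_singleton (sub_ne_zero.2 h.symm)]

/-- `p₃` lies in the plane of the other three points; `f` and `g` each vanish on one of the two edge
directions at `p₀` and not on the other, so these are independent. -/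
lemma dim_quadrilateral {p₀ p₁ p₂ p₃ : E} {b₁ b₂ : ℝ} (f g : E →ᵃ[ℝ] ℝ)
    (h : p₃ - p₀ = b₁ • (p₁ - p₀) + b₂ • (p₂ - p₀)) (hf₀ : f p₀ = 0) (hf₁ : f p₁ = 0)
    (hf₂ : f p₂ ≠ 0) (hg₀ : g p₀ = 0) (hg₁ : g p₁ ≠ 0) (hg₂ : g p₂ = 0) :
    dim (convexHull ℝ {p₀, p₁, p₂, p₃}) = 2 := by
  rw [dim, vectorSpan_convexHull,
    vectorSpan_eq_span_vsub_set_right ℝ (mem_insert p₀ {p₁, p₂, p₃})]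
  have h1 : (fun x => x -ᵥ p₀) '' ({p₀, p₁, p₂, p₃} : Set E) =
      {0, p₁ - p₀, p₂ - p₀, p₃ - p₀} := by
    simp [image_insert_eq]
  have h2 : Submodule.span ℝ ({p₁ - p₀, p₂ - p₀, p₃ - p₀} : Set E) =
      Submodule.span ℝ (range ![p₁ - p₀, p₂ - p₀]) := by
    refine le_antisymm (Submodule.span_le.2 ?_) (Submodule.span_mono ?_)
    · have m1 : p₁ - p₀ ∈ Submodule.span ℝ (range ![p₁ - p₀, p₂ - p₀]) :=
        Submodule.subset_span ⟨0, rfl⟩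
      have m2 : p₂ - p₀ ∈ Submodule.span ℝ (range ![p₁ - p₀, p₂ - p₀]) :=
        Submodule.subset_span ⟨1, rfl⟩
      rintro x (rfl | rfl | rfl)
      · exact m1
      · exact m2
      · rw [h]
        exact Submodule.add_mem _ (Submodule.smul_mem _ _ m1) (Submodule.smul_mem _ _ m2)
    · rintro _ ⟨i, rfl⟩
      fin_cases i <;> simp
  have h3 : LinearIndependent ℝ ![p₁ - p₀, p₂ - p₀] := by
    rw [LinearIndependent.pair_iff]
    intro s t hst
    have e1 := congrArg f.linear hst
    have e2 := congrArg g.linear hst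
    simp only [map_add, map_smul, affine_sub, hf₀, hf₁, hg₀, hg₂, map_zero, smul_eq_mul, sub_zero,
      mul_zero, zero_add, add_zero] at e1 e2
    exact ⟨(mul_eq_zero.1 e2).resolve_right hg₁, (mul_eq_zero.1 e1).resolve_right hf₂⟩
  rw [h1, Submodule.span_insert_zero, h2, finrank_span_eq_card h3, Fintype.card_fin]

end Dimension

/-! ### Opposite edges in the lifted Möbius strip -/

section MoebiusStrip

variable {m : ℕ} [NeZero m] {E : Type*} [NormedAddCommGroup E] [NormedSpace ℝ E]
  [FiniteDimensional ℝ E] (Φ : ((Fin 3 → ℝ) × (Fin m → ℝ)) ≃ₗ[ℝ] E)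

/-- The boundary complex of the polytope. -/
abbrev fiberComplex : Set (Set E) := boundaryComplex (polyhedron (fiberFacet Φ))

lemma isEdge_fiberFace {S : Finset (Fin 36)} (hS : IsInnerFace S) (h : S.card = 2) :
    IsEdge (fiberComplex Φ) (fiberFace Φ S 0) := by
  refine ⟨(fiberFace_mem Φ hS 0).1, ?_⟩
  obtain ⟨a, b, hab, rfl⟩ := Finset.card_eq_two.1 h
  rw [fiberFace_zero, Finset.coe_pair, image_pair]
  exact dim_segment fun h => hab (fiberPoint_injective Φ h)

omit [NeZero m] [FiniteDimensional ℝ E] in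
lemma slack_eq_zero_iff (i : Fin m) (j : Fin 46) (v : Fin 36) :
    fiberFacet Φ (j, i, true) (fiberPoint Φ v fun _ => true) = 0 ↔ slack j v = 0 := by
  simp [fiberFacet_eq_zero_iff]

omit [FiniteDimensional ℝ E] in
lemma dim_fiberFace_quad {p : Strip} (hp : p ∈ moebiusStrip) :
    dim (fiberFace Φ p.quad 0) = 2 := by
  obtain ⟨ha, hdep⟩ := moebiusStrip_dependent p hp
  obtain ⟨j, hj₀, hj₁, hj₂, -⟩ := moebiusStrip_opposite p hp
  obtain ⟨k, hk₀, hk₂, hk₁⟩ := moebiusStrip_adjacent p hp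
  let P : Fin 36 → E := fun v => fiberPoint Φ v fun _ => true
  -- Passing from homogeneous to affine coordinates weights each coefficient by `hat _ 0`; the
  -- weighted coefficients sum to zero, so differences from `p₀` suffice.
  have hcomb : (p.a₃ * hat p.p₃ 0 : ℝ) • (P p.p₃ - P p.p₀) =
      (-(p.a₁ * hat p.p₁ 0) : ℝ) • (P p.p₁ - P p.p₀) +
        (-(p.a₂ * hat p.p₂ 0) : ℝ) • (P p.p₂ - P p.p₀) := by
    have hd : ∀ k, (p.a₀ * hat p.p₀ k + p.a₁ * hat p.p₁ k + p.a₂ * hat p.p₂ k +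
        p.a₃ * hat p.p₃ k : ℝ) = 0 := fun k => by exact_mod_cast hdep k
    have n0 := (hat_zero_pos' p.p₀).ne'
    have n1 := (hat_zero_pos' p.p₁).ne'
    have n2 := (hat_zero_pos' p.p₂).ne'
    have n3 := (hat_zero_pos' p.p₃).ne'
    have key : ∀ k, (p.a₃ * hat p.p₃ 0 : ℝ) * (hat p.p₃ k / hat p.p₃ 0 - hat p.p₀ k / hat p.p₀ 0) =
        -(p.a₁ * hat p.p₁ 0) * (hat p.p₁ k / hat p.p₁ 0 - hat p.p₀ k / hat p.p₀ 0) +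
        -(p.a₂ * hat p.p₂ 0) * (hat p.p₂ k / hat p.p₂ 0 - hat p.p₀ k / hat p.p₀ 0) := by
      intro k
      field_simp
      linear_combination (hat p.p₀ 0 : ℝ) * hd k - (hat p.p₀ k : ℝ) * hd 0
    simp only [P, fiberPoint, ← map_sub, ← map_smul, ← map_add]
    congr 1
    refine Prod.ext (funext fun k => ?_) (funext fun i => ?_)
    · exact key _
    · simpa [boolSign] using key 4
  have hne : (p.a₃ * hat p.p₃ 0 : ℝ) ≠ 0 :=
    mul_ne_zero (by exact_mod_cast ha) (hat_zero_pos' _).ne'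
  rw [fiberFace_zero, Strip.quad]
  have himg : P '' (({p.p₀, p.p₁, p.p₂, p.p₃} : Finset (Fin 36)) : Set (Fin 36)) =
      {P p.p₀, P p.p₁, P p.p₂, P p.p₃} := by
    simp [image_insert_eq]
  change dim (convexHull ℝ (P '' _)) = 2
  rw [himg]
  refine dim_quadrilateral (fiberFacet Φ (j, 0, true)) (fiberFacet Φ (k, 0, true))
    (b₁ := (p.a₃ * hat p.p₃ 0 : ℝ)⁻¹ * -(p.a₁ * hat p.p₁ 0))
    (b₂ := (p.a₃ * hat p.p₃ 0 : ℝ)⁻¹ * -(p.a₂ * hat p.p₂ 0)) ?_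
    ((slack_eq_zero_iff Φ 0 j _).2 hj₀) ((slack_eq_zero_iff Φ 0 j _).2 hj₁)
    (mt (slack_eq_zero_iff Φ 0 j _).1 hj₂) ((slack_eq_zero_iff Φ 0 k _).2 hk₀)
    (mt (slack_eq_zero_iff Φ 0 k _).1 hk₁) ((slack_eq_zero_iff Φ 0 k _).2 hk₂)
  rw [mul_smul, mul_smul, ← smul_add, ← hcomb, smul_smul, inv_mul_cancel₀ hne, one_smul]

omit [FiniteDimensional ℝ E] in
lemma disjoint_fiberFace {p : Strip} (hp : p ∈ moebiusStrip) :
    Disjoint (fiberFace Φ p.fst 0) (fiberFace Φ p.snd 0) := by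
  obtain ⟨j, h₀, h₁, h₂, h₃⟩ := moebiusStrip_opposite p hp
  let f := fiberFacet Φ (j, 0, true)
  have hf : fiberFace Φ p.fst 0 ⊆ f ⁻¹' {0} := by
    rw [fiberFace_zero]
    refine convexHull_min ?_ ((convex_singleton (0 : ℝ)).affine_preimage f)
    rintro _ ⟨v, hv, rfl⟩
    refine (slack_eq_zero_iff Φ 0 j v).2 ?_
    simp only [Strip.fst, Finset.coe_pair, mem_insert_iff, mem_singleton_iff] at hv
    rcases hv with rfl | rfl <;> assumption
  have hs : fiberFace Φ p.snd 0 ⊆ f ⁻¹' Ioi 0 := by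
    rw [fiberFace_zero]
    refine convexHull_min ?_ ((convex_Ioi (0 : ℝ)).affine_preimage f)
    rintro _ ⟨v, hv, rfl⟩
    refine (fiberFacet_nonneg Φ (j, 0, true) v _).lt_of_ne'
      (mt (slack_eq_zero_iff Φ 0 j v).1 ?_)
    simp only [Strip.snd, Finset.coe_pair, mem_insert_iff, mem_singleton_iff] at hv
    rcases hv with rfl | rfl <;> assumption
  refine disjoint_left.2 fun x hx hx' => ?_
  have e1 : f x = 0 := hf hx
  have e2 : 0 < f x := hs hx'
  exact e2.ne' e1

lemma opposite_fiberFace {p : Strip} (hp : p ∈ moebiusStrip) (hq : IsInnerFace p.quad)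
    (h₁ : IsInnerFace p.fst) (h₂ : IsInnerFace p.snd) {F : Set E} (hF : fiberFace Φ p.quad 0 ⊆ F) :
    Opposite (fiberComplex Φ) F (fiberFace Φ p.fst 0) (fiberFace Φ p.snd 0) := by
  obtain ⟨c₂, c₁, -⟩ := moebiusStrip_card p hp
  refine ⟨_, (fiberFace_mem Φ hq 0).1, dim_fiberFace_quad Φ hp, hF, isEdge_fiberFace Φ h₁ c₁,
    isEdge_fiberFace Φ h₂ c₂, fiberFace_mono Φ ?_ le_rfl, fiberFace_mono Φ ?_ le_rfl,
    disjoint_fiberFace Φ hp⟩ <;>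
  · intro v hv
    simp only [Strip.fst, Strip.snd, Strip.quad, Finset.mem_insert, Finset.mem_singleton] at hv ⊢
    tauto

end MoebiusStrip

/-! ### Extending flags of the ball through the fiber directions -/

namespace BallFlag

/-- The faces of a flag of the polytope over the flag `f` of the ball: the passage from the
quadrilateral to the cell occurs after `p` fiber directions have been added. -/
def face (f : BallFlag) (p : ℕ) : ℕ → Finset (Fin 36) × ℕ
  | 0 => (f.e, 0)
  | 1 => (f.q, 0)
  | j + 2 => if j < p then (f.q, j + 1) else (zeroSet f.c, j)

variable {f g : BallFlag}

lemma IsValid.isInnerFace_e (hf : f.IsValid) : IsInnerFace f.e :=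
  ⟨hf.2.1, f.c, hf.2.2.2.2.2, hf.2.2.2.1.1.trans hf.2.2.2.2.1.1⟩

lemma IsValid.isInnerFace_q (hf : f.IsValid) : IsInnerFace f.q :=
  ⟨hf.2.2.1, f.c, hf.2.2.2.2.2, hf.2.2.2.2.1.1⟩

lemma IsValid.isInnerFace_c (hf : f.IsValid) : IsInnerFace (zeroSet f.c) :=
  ⟨isBallFace_zeroSet (hf.2.2.1.1.mono hf.2.2.2.2.1.1), f.c, hf.2.2.2.2.2, subset_rfl⟩

lemma IsValid.isInnerFace_face (hf : f.IsValid) (p i : ℕ) : IsInnerFace (f.face p i).1 := by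
  match i with
  | 0 => exact hf.isInnerFace_e
  | 1 => exact hf.isInnerFace_q
  | j + 2 =>
    simp only [face]
    split_ifs
    · exact hf.isInnerFace_q
    · exact hf.isInnerFace_c

lemma face_snd_le {k p i : ℕ} (hp : p ≤ k) (hi : i < k + 3) : (f.face p i).2 ≤ k := by
  match i with
  | 0 => exact k.zero_le
  | 1 => exact k.zero_le
  | j + 2 =>
    simp only [face]
    split_ifs <;> dsimp only <;> omega

lemma IsValid.strictMono_face (hf : f.IsValid) (p : ℕ) : StrictMono (f.face p) := by
  refine strictMono_nat_of_lt_succ fun i => ?_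
  have hq := hf.2.2.2.2.1
  match i with
  | 0 => exact Prod.mk_lt_mk.2 (.inl ⟨hf.2.2.2.1, le_rfl⟩)
  | 1 =>
    simp only [face]
    split_ifs
    · exact Prod.mk_lt_mk.2 (.inr ⟨le_rfl, by omega⟩)
    · exact Prod.mk_lt_mk.2 (.inl ⟨hq, by omega⟩)
  | j + 2 =>
    simp only [face]
    split_ifs
    · exact Prod.mk_lt_mk.2 (.inr ⟨le_rfl, by omega⟩)
    · exact Prod.mk_lt_mk.2 (.inl ⟨hq, by omega⟩)
    · omega
    · exact Prod.mk_lt_mk.2 (.inr ⟨le_rfl, by omega⟩)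

end BallFlag

/-! ### Transporting the sign around the Möbius strip -/

section Nonorientable

variable {k : ℕ} {E : Type*} [NormedAddCommGroup E] [NormedSpace ℝ E] [FiniteDimensional ℝ E]
  (Φ : ((Fin 3 → ℝ) × (Fin (k + 1) → ℝ)) ≃ₗ[ℝ] E) {f g : BallFlag}

/-- The pairs of a flag of the derivative complex over a flag of the ball. -/
def fiberFlag (f : BallFlag) (p : ℕ) (i : Fin (k + 3)) : Set E × Set (Set E) :=
  derivedPair (fiberComplex Φ) (fiberFace Φ f.e 0)
    (fiberFace Φ (f.face p i).1 (f.face p i).2)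

lemma fiberFace_face_ssubset (hf : f.IsValid) {p : ℕ} (hp : p ≤ k) {i j : Fin (k + 3)}
    (h : i < j) : fiberFace Φ (f.face p i).1 (f.face p i).2 ⊂
      fiberFace Φ (f.face p j).1 (f.face p j).2 :=
  fiberFace_ssubset Φ (hf.isInnerFace_face p i) (hf.isInnerFace_face p j)
    (Nat.lt_succ_of_le (BallFlag.face_snd_le hp i.2))
    (Nat.lt_succ_of_le (BallFlag.face_snd_le hp j.2)) (hf.strictMono_face p h)

lemma strictMono_fiberFlag (hf : f.IsValid) {p : ℕ} (hp : p ≤ k) :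
    StrictMono (fiberFlag Φ f p) := fun _ _ h =>
  derivedPair_lt _ (fiberFace_face_ssubset Φ hf hp h)

/-- The edge of a flag of the ball gives a vertex of the given component. -/
def IsReached (x : DerivativeComplex (fiberComplex Φ)) (f : BallFlag) : Prop :=
  Represents (component x)
    (derivedPair (fiberComplex Φ) (fiberFace Φ f.e 0) (fiberFace Φ f.e 0))

variable {x : DerivativeComplex (fiberComplex Φ)}

lemma represents_fiberFlag (hf : f.IsValid) (hx : IsReached Φ x f) (p : ℕ) (i : Fin (k + 3)) :
    Represents (component x) (fiberFlag Φ f p i) := by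
  refine represents_of_subset (isEdge_fiberFace Φ hf.isInnerFace_e hf.1)
    (fiberFace_mem Φ (hf.isInnerFace_face p i) _).1 ?_ hx
  have := (hf.strictMono_face p).monotone (Nat.zero_le i)
  exact fiberFace_mono Φ this.1 this.2

lemma fiberFlag_ne (hf : f.IsValid) (hg : g.IsValid) {p p' : ℕ} (hp : p ≤ k) (hp' : p' ≤ k)
    {i : Fin (k + 3)} (h : f.face p i ≠ g.face p' i) : fiberFlag Φ f p i ≠ fiberFlag Φ g p' i :=
  fun heq => h <| Prod.ext_iff.2 <| fiberFace_injective Φ (hf.isInnerFace_face p i)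
    (hg.isInnerFace_face p' i) (Nat.lt_succ_of_le (BallFlag.face_snd_le hp i.2))
    (Nat.lt_succ_of_le (BallFlag.face_snd_le hp' i.2)) (congrArg Prod.fst heq)

lemma not_isOrientable_component
    (hx : IsReached Φ x walkStart) :
    ¬ IsOrientable (k + 2) (barycentricSubdivision (component x)) := by
  intro hor
  obtain ⟨χ, hχ⟩ := exists_sign_of_isOrientable hor
  have flip : ∀ {f g : BallFlag} {p p' : ℕ}, f.IsValid → g.IsValid → IsReached Φ x f →
      IsReached Φ x g → p ≤ k → p' ≤ k → ∀ i : Fin (k + 3),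
      (∀ j, j ≠ i → fiberFlag Φ f p j = fiberFlag Φ g p' j) → f.face p i ≠ g.face p' i →
      χ (fiberFlag Φ f p) = -χ (fiberFlag Φ g p') :=
    fun hf hg hfx hgx hp hp' i hj hi => hχ _ _ (strictMono_fiberFlag Φ hf hp)
      (strictMono_fiberFlag Φ hg hp') (represents_fiberFlag Φ hf hfx _)
      (represents_fiberFlag Φ hg hgx _) i hj (fiberFlag_ne Φ hf hg hp hp' hi)
  -- Raising `p` by one replaces only the cell `(zeroSet f.c, p)` at index `p + 2` by `(f.q, p +
  -- 1)`.
  have raise : ∀ {f : BallFlag}, f.IsValid → IsReached Φ x f → ∀ p ≤ k,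
      χ (fiberFlag Φ f 0) = (-1) ^ p * χ (fiberFlag Φ f p) := by
    intro f hf hfx p
    induction p with
    | zero => simp
    | succ p ih =>
      intro hp
      rw [ih (by omega), flip hf hf hfx hfx (by omega) hp ⟨p + 2, by omega⟩ ?_ ?_, pow_succ,
        mul_neg, mul_neg_one, neg_mul]
      · rintro ⟨j, hj⟩ hne
        have hj' : j ≠ p + 2 := fun h => hne (Fin.ext h)
        have : f.face p j = f.face (p + 1) j := by
          match j with
          | 0 => rfl
          | 1 => rfl
          | j + 2 =>
            simp only [BallFlag.face, show j < p + 1 ↔ j < p by omega]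
        simp only [fiberFlag, this]
      · simp [BallFlag.face]
  have step : ∀ f g : BallFlag, (f.IsValid ∧ IsReached Φ x f) → f.Step g →
      (g.IsValid ∧ IsReached Φ x g) ∧ χ (fiberFlag Φ f 0) = -χ (fiberFlag Φ g 0) := by
    rintro f g ⟨hf, hfx⟩ ⟨hg, ⟨hq, hc, p, hp, he, he', hpq⟩ | ⟨he, hc, hq⟩ | ⟨he, hq, hc⟩⟩
    -- Every face containing the quadrilateral has the same parallel class for both opposite edges,
    -- so only the pair at index 0 changes.
    · have hopp : ∀ F, fiberFace Φ f.q 0 ⊆ F →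
          Opposite (fiberComplex Φ) F (fiberFace Φ f.e 0) (fiberFace Φ g.e 0) := fun F hF => by
        rw [he, he']
        exact opposite_fiberFace Φ hp (hpq ▸ hf.isInnerFace_q) (he ▸ hf.isInnerFace_e)
          (he' ▸ hg.isInnerFace_e) (hpq ▸ hF)
      have hgx : IsReached Φ x g :=
        represents_of_opposite (fiberFace_mem Φ hf.isInnerFace_q 0).1 (hopp _ subset_rfl) hfx
      refine ⟨⟨hg, hgx⟩, flip hf hg hfx hgx k.zero_le k.zero_le 0 ?_ ?_⟩
      · intro j hj
        obtain ⟨j, hjk⟩ := j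
        obtain ⟨j, rfl⟩ : ∃ i, j = i + 1 := Nat.exists_eq_succ_of_ne_zero fun h => hj (Fin.ext h)
        have hface : f.face 0 (j + 1) = g.face 0 (j + 1) := by
          cases j <;> simp [BallFlag.face, hq, hc]
        have hmono := (hf.strictMono_face 0).monotone (show 1 ≤ j + 1 by omega)
        simp only [fiberFlag, ← hface, derivedPair]
        rw [parallelClass_congr (hopp _ (fiberFace_mono Φ hmono.1 hmono.2))]
      · simpa [BallFlag.face, he, he'] using (moebiusStrip_card p hp).2.2
    · have hgx : IsReached Φ x g := by rwa [IsReached, ← he]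
      refine ⟨⟨hg, hgx⟩, flip hf hg hfx hgx k.zero_le k.zero_le 1 ?_ ?_⟩
      · rintro ⟨j, hj⟩ hne
        have hface : f.face 0 j = g.face 0 j := by
          match j with
          | 0 => simp [BallFlag.face, he]
          | 1 => exact absurd rfl hne
          | j + 2 => simp [BallFlag.face, hc]
        simp only [fiberFlag, hface, he]
      · simpa [BallFlag.face] using hq
    · have hgx : IsReached Φ x g := by rwa [IsReached, ← he]
      refine ⟨⟨hg, hgx⟩, ?_⟩
      -- With `p = 0` a change of the cell would affect every index from 2 on. With `p = k` the cell
      -- enters only at the last index, and the two factors `(-1) ^ k` cancel.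
      rw [raise hf hfx k le_rfl, raise hg hgx k le_rfl, ← mul_neg]
      congr 1
      refine flip hf hg hfx hgx le_rfl le_rfl (Fin.last (k + 2)) ?_ ?_
      · rintro ⟨j, hj⟩ hne
        have hj' : j ≠ k + 2 := fun h => hne (Fin.ext h)
        have hface : f.face k j = g.face k j := by
          match j with
          | 0 => simp [BallFlag.face, he]
          | 1 => simp [BallFlag.face, hq]
          | j + 2 => simp [BallFlag.face, hq, show j < k by omega]
        simp only [fiberFlag, hface, he]
      · simpa [BallFlag.face] using hc
  have := sign_eq_of_isChain (fun f => χ (fiberFlag Φ f 0)) step walkStart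
    ⟨isValid_walkStart, hx⟩ walkData isChain_walk
  rw [getLast_walk, length_walk] at this
  -- What remains is `u = (-1) ^ 41 * u`, impossible for a unit of `ℤ`.
  generalize χ (fiberFlag Φ walkStart 0) = u at this
  revert this
  revert u
  decide

end Nonorientable

end Cubical

theorem mainTheorem8 (d : ℕ) (hd : 4 ≤ d) :
    ∃ P : Set (EuclideanSpace ℝ (Fin d)), Cubical.IsCubicalPolytope d P ∧
      ∃ M : Set (Cubical.DerivativeComplex (Cubical.boundaryComplex P)),
        Cubical.IsDualManifold (Cubical.boundaryComplex P) M ∧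
        ¬ Cubical.IsOrientable (d - 2) (Cubical.barycentricSubdivision M) := by
  obtain ⟨k, rfl⟩ := Nat.exists_eq_add_of_le' hd
  -- Here `d = k + 4` and `m = k + 1`. Only the linear structure matters, so any linear isomorphism
  -- will do.
  let Φ : ((Fin 3 → ℝ) × (Fin (k + 1) → ℝ)) ≃ₗ[ℝ] EuclideanSpace ℝ (Fin (k + 4)) :=
    LinearEquiv.ofFinrankEq _ _ (by simp; omega)
  have he := Cubical.isValid_walkStart.isInnerFace_e
  have hedge := Cubical.isEdge_fiberFace Φ he Cubical.isValid_walkStart.1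
  let x : Cubical.DerivativeComplex (Cubical.fiberComplex Φ) :=
    Cubical.derivedCell hedge.1 hedge subset_rfl
  refine ⟨Cubical.polyhedron (Cubical.fiberFacet Φ), ?_, Cubical.component x, ⟨x, rfl⟩,
    Cubical.not_isOrientable_component Φ ⟨x, .refl _, rfl⟩⟩
  have := (Cubical.isCubicalSystem_fiberFacet Φ).isCubicalPolytope
    (Cubical.finite_fiberVertices Φ) (by simp)
  simpa using this
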